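/- **Doubled Quantum Theory.** The trivial system is the one-dimensional Hilbert space $\mathbb C$, regarded as an even sector. Every other system is a pair $(\mathcal H_0,\mathcal H_1)$ of isomorphic, non-zero, finite-dimensional complex Hilbert spaces (the even and the odd sector), with total space $\mathcal H_0\oplus\mathcal H_1$. Systems compose according to total parity: $\mathcal H^{AB}_0=(\mathcal H^A_0\otimes\mathcal H^B_0)\oplus(\mathcal H^A_1\otimes\mathcal H^B_1)$ and $\mathcal H^{AB}_1=(\mathcal H^A_0\otimes\mathcal H^B_1)\oplus(\mathcal H^A_1\otimes\mathcal H^B_0)$. A test from $A$ to $B$ is a finite quantum instrument $\{\mathcal C_i\}$ (completely positive maps with trace-preserving sum) in which every $\mathcal C_i$ maps block diagonal operators (those without matrix elements between sectors of different parity) to block diagonal operators, also when applied to one part of a composite system. Transformations are the members of tests; channels are one-outcome tests; states (effects) are the transformations from (to) the trivial system, namely the block diagonal positive operators of trace at most $1$ (the block diagonal quantum effects). A transformation is reversible if it has an inverse transformation. A unitary matrix $U$ on a system is *allowed* if $X\mapsto UXU^\dagger$ maps block diagonal operators to block diagonal operators. A *RaRe channel* on a system is a channel $\sum_i p_i\,\mathcal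 U_i$ with $\{p_i\}$ a finite probability distribution and $\mathcal U_i$ reversible transformations of that system. **Theorem.** 1. Doubled Quantum Theory is an operational-probabilistic theory (tests are closed under sequential and parallel composition and under coarse-graining, and contain the identities and the structural isomorphisms, including swaps; closed circuits give probabilities; transformations with the same statistics on all composite systems are equal), with finite-dimensional state spaces and with closed and convex sets of transformations. It is a sharp theory with purification, that is, it satisfies: * *Causality*: the probability of an outcome of a test does not depend on the choice of observation-test performed on its output. * *Purity Preservation*: sequential and parallel compositions of pure transformations are pure. Here a transformation $\mathcal C$ is pure if every refinement $\{\mathcal D_j\}$ of it is of the form $\mathcal D_j=p_j\,\mathcal C$ with $\{p_j\}$ a probability distribution. * *Pure Sharpness*: every system has a pure effect that occurs with probability $1$ on some state. * *Purification*: every state of every system $A$ is the marginal, under some deterministic effect on $B$, of a pure state of some composite $A\otimes B$. If $(\Psi,e)$ and $(\Psi',e')$ are two such purifications of the same state with the same $B$, there is a reversible transformation $\mathcal U$ of $B$ with $\Psi'=(\mathcal I_A\otimes\mathcal U)\Psi$ and $e=e'\,\mathcal U$. 2. The reversible transformations of a system are exactly the maps $X\mapsto UXU^\dagger$ with $U$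 an allowed unitary. 3. Let $\{|0,0\rangle,|0,1\rangle\}$ and $\{|1,0\rangle,|1,1\rangle\}$ be orthonormal bases of the sectors $\mathcal H_0\simeq\mathbb C^2$ and $\mathcal H_1\simeq\mathbb C^2$ of the doubled qubit, and let $$\rho=\tfrac12\big(|0,0\rangle\langle 0,0|+|0,1\rangle\langle 0,1|\big),\qquad \sigma=\tfrac12|0,0\rangle\langle 0,0|\oplus\tfrac12|1,0\rangle\langle 1,0| .$$ These are normalised states with the same spectrum: they have the same characteristic polynomial, and both have eigenvalue vector $(\tfrac12,\tfrac12,0,0)$ with respect to diagonalisations over maximal sets of perfectly distinguishable pure states. Hence any eigenvalue vectors of $\rho$ and $\sigma$ majorise each other. Yet no allowed unitary $U$ satisfies $\sigma=U\rho U^\dagger$, and no RaRe channel converts $\rho$ into $\sigma$, or $\sigma$ into $\rho$. 4. Consequently, in Doubled Quantum Theory majorisation is not sufficient for RaRe convertibility: it is not true that a normalised state $\rho'$ can be converted by a RaRe channel into a normalised state $\sigma'$ of the same system whenever the eigenvalues of $\rho'$ majorise those of $\sigma'$. -/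

import Mathlib

open CategoryTheory MonoidalCategory Matrix
open scoped Kronecker ComplexOrder

/-! ## Operational-probabilistic theories -/

/-- The data of an operational-probabilistic theory.  Systems are the objects of a symmetric
monoidal category `C`; the real vector spaces `A ⟶ B` contain the physical transformations.
The theory specifies which finite families of arrows are tests, and how an arrow from the trivial
system to itself is read as a number. -/
structure OPData (C : Type 1) [Category.{0} C] [MonoidalCategory C] [Preadditive C]
    [Linear ℝ C] where
  /-- The family `t` of arrows, indexed by a finite set `X` of outcomes, is a test. -/
  IsTest : ∀ {A B : C} {X : Type} [Fintype X], (X → (A ⟶ B)) → Prop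
  /-- The number represented by a scalar. -/
  prob : (𝟙_ C ⟶ 𝟙_ C) →ₗ[ℝ] ℝ

namespace OPData

section Basic

variable {C : Type 1} [Category.{0} C] [MonoidalCategory C] [Preadditive C] [Linear ℝ C]
variable (T : OPData C)

/-- Physical transformations are the members of tests.  States of `A` are the transformations
`𝟙_ C ⟶ A`, effects on `A` are the transformations `A ⟶ 𝟙_ C`. -/
def IsTransf {A B : C} (f : A ⟶ B) : Prop :=
  ∃ (X : Type) (_ : Fintype X) (t : X → (A ⟶ B)), T.IsTest t ∧ ∃ x, t x = f

/-- Deterministic transformations (channels) are those forming a one-outcome test. -/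
def IsChannel {A B : C} (f : A ⟶ B) : Prop :=
  T.IsTest (fun _ : Unit => f)

/-- Reversible transformations. -/
def IsReversible {A B : C} (f : A ⟶ B) : Prop :=
  T.IsTransf f ∧ ∃ g : B ⟶ A, T.IsTransf g ∧ f ≫ g = 𝟙 A ∧ g ≫ f = 𝟙 B

open scoped Classical in
/-- The family `c` is obtained from the family `d` by joining outcomes along the partition of
`Y` into the (non-empty) fibres of `r`. -/
def IsCoarseGraining {A B : C} {X Y : Type} [Fintype Y] (c : X → (A ⟶ B)) (d : Y → (A ⟶ B))
    (r : Y → X) : Prop :=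
  Function.Surjective r ∧ ∀ i, c i = ∑ j ∈ Finset.univ.filter (fun j => r j = i), d j

open scoped Classical in
/-- A transformation `f` is pure if all its refinements are trivial: whenever `f` is the member
`c i` of a test `c` and `d` is a test refining `c`, the arrows of `d` that are joined into
`c i` are `p j • f` for a probability distribution `p`. -/
def IsPure {A B : C} (f : A ⟶ B) : Prop :=
  T.IsTransf f ∧
  ∀ (X Y : Type) [Fintype X] [Fintype Y] (c : X → (A ⟶ B)) (d : Y → (A ⟶ B)) (r : Y → X) (i : X),
    T.IsTest c → T.IsTest d → IsCoarseGraining c d r → c i = f →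
      ∃ p : Y → ℝ, (∀ j, r j = i → 0 ≤ p j) ∧
        ∑ j ∈ Finset.univ.filter (fun j => r j = i), p j = 1 ∧
        ∀ j, r j = i → d j = p j • f

/-- Causality: the probability of an outcome of a test is independent of the choice of the
observation-test performed on its output. -/
def Causality : Prop :=
  ∀ (A B : C) (W X Y Z : Type) [Fintype W] [Fintype X] [Fintype Y] [Fintype Z]
    (s : W → (𝟙_ C ⟶ A)) (c : X → (A ⟶ B)) (a : Y → (B ⟶ 𝟙_ C)) (b : Z → (B ⟶ 𝟙_ C)),
    T.IsTest s → T.IsTest c → T.IsTest a → T.IsTest b →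
      ∀ w x, ∑ y, T.prob (s w ≫ c x ≫ a y) = ∑ z, T.prob (s w ≫ c x ≫ b z)

/-- Purity Preservation: sequential and parallel compositions of pure transformations are pure. -/
def PurityPreservation : Prop :=
  (∀ (A B D : C) (f : A ⟶ B) (g : B ⟶ D), T.IsPure f → T.IsPure g → T.IsPure (f ≫ g)) ∧
  (∀ (A B D E : C) (f : A ⟶ B) (g : D ⟶ E), T.IsPure f → T.IsPure g → T.IsPure (f ⊗ₘ g))

/-- Pure Sharpness: every system has a pure effect occurring with unit probability on some
state. -/
def PureSharpness : Prop :=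
  ∀ A : C, ∃ a : A ⟶ 𝟙_ C, T.IsPure a ∧ ∃ s : 𝟙_ C ⟶ A, T.IsTransf s ∧ T.prob (s ≫ a) = 1

/-- The state of `A` obtained from a state of `A ⊗ B` by applying the effect `e` on `B`. -/
def marginal {A B : C} (Ψ : 𝟙_ C ⟶ A ⊗ B) (e : B ⟶ 𝟙_ C) : 𝟙_ C ⟶ A :=
  Ψ ≫ (A ◁ e) ≫ (ρ_ A).hom

/-- `Ψ` is a purification of the state `s`, with respect to the deterministic effect `e`. -/
def IsPurification {A B : C} (s : 𝟙_ C ⟶ A) (Ψ : 𝟙_ C ⟶ A ⊗ B) (e : B ⟶ 𝟙_ C) : Prop :=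
  T.IsPure Ψ ∧ T.IsChannel e ∧ marginal Ψ e = s

/-- Purification: every state has a purification, and purifications with the same purifying
system are unique up to a reversible transformation of the purifying system. -/
def Purification : Prop :=
  (∀ (A : C) (s : 𝟙_ C ⟶ A), T.IsTransf s →
    ∃ (B : C) (Ψ : 𝟙_ C ⟶ A ⊗ B) (e : B ⟶ 𝟙_ C), T.IsPurification s Ψ e) ∧
  (∀ (A B : C) (s : 𝟙_ C ⟶ A) (Ψ Ψ' : 𝟙_ C ⟶ A ⊗ B) (e e' : B ⟶ 𝟙_ C),
    T.IsTransf s → T.IsPurification s Ψ e → T.IsPurification s Ψ' e' →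
      ∃ U : B ⟶ B, T.IsReversible U ∧ Ψ' = Ψ ≫ (A ◁ U) ∧ e = U ≫ e')

/-- Sharp theories with purification. -/
structure IsSharpWithPurification : Prop where
  causality : T.Causality
  purityPreservation : T.PurityPreservation
  pureSharpness : T.PureSharpness
  purification : T.Purification

/-- Random reversible channels on a system. -/
def IsRaRe {A : C} (R : A ⟶ A) : Prop :=
  T.IsChannel R ∧ ∃ (n : ℕ) (p : Fin n → ℝ) (U : Fin n → (A ⟶ A)),
    (∀ i, 0 ≤ p i) ∧ ∑ i, p i = 1 ∧ (∀ i, T.IsReversible (U i)) ∧ R = ∑ i, p i • U i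

/-- The state `s` can be converted into the state `t` by a RaRe channel. -/
def RaReConvertible {A : C} (s t : 𝟙_ C ⟶ A) : Prop :=
  ∃ R : A ⟶ A, T.IsRaRe R ∧ s ≫ R = t

/-- The states `s x` are perfectly distinguishable. -/
def PerfectlyDistinguishable {A : C} {X : Type} [Fintype X] (s : X → (𝟙_ C ⟶ A)) : Prop :=
  (∀ x, T.IsTransf (s x)) ∧ ∃ a : X → (A ⟶ 𝟙_ C), T.IsTest a ∧
    (∀ x, T.prob (s x ≫ a x) = 1) ∧ ∀ x y, x ≠ y → T.prob (s x ≫ a y) = 0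

/-- Maximal sets of perfectly distinguishable pure states. -/
def IsPureMaximal {A : C} {X : Type} [Fintype X] (s : X → (𝟙_ C ⟶ A)) : Prop :=
  (∀ x, T.IsPure (s x)) ∧ T.PerfectlyDistinguishable s ∧
    ¬ ∃ s₀ : 𝟙_ C ⟶ A, T.PerfectlyDistinguishable (fun o : Option X => o.elim s₀ s)

/-- `p` is a vector of eigenvalues of the state `s`: the coefficients of a diagonalisation of `s`
over a pure maximal set. -/
def IsSpectrum {A : C} (s : 𝟙_ C ⟶ A) {d : ℕ} (p : Fin d → ℝ) : Prop :=
  (∀ i, 0 ≤ p i) ∧ ∑ i, p i = 1 ∧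
    ∃ α : Fin d → (𝟙_ C ⟶ A), T.IsPureMaximal α ∧ s = ∑ i, p i • α i

end Basic

/-- The entries of `x` rearranged in decreasing order. -/
noncomputable def decreasing {d : ℕ} (x : Fin d → ℝ) : Fin d → ℝ :=
  fun i => x (Tuple.sort x (Fin.rev i))

/-- The vector `x` majorises the vector `y`. -/
def Majorises {d : ℕ} (x y : Fin d → ℝ) : Prop :=
  (∀ k : ℕ, k < d →
    ∑ i ∈ Finset.univ.filter (fun i : Fin d => i.val < k), decreasing y i ≤
      ∑ i ∈ Finset.univ.filter (fun i : Fin d => i.val < k), decreasing x i) ∧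
  ∑ i, x i = ∑ i, y i

section Laws

variable {C : Type 1} [Category.{0} C] [MonoidalCategory C] [Preadditive C] [Linear ℝ C]
variable (T : OPData C)

/-- In the theory `T`, majorisation of the spectra suffices for the convertibility of normalised
states by RaRe channels. -/
def MajorisationSufficesForRaRe : Prop :=
  ∀ (A : C) (s t : 𝟙_ C ⟶ A) (d : ℕ) (p q : Fin d → ℝ), T.IsChannel s → T.IsChannel t →
    T.IsSpectrum s p → T.IsSpectrum t q → Majorises p q → T.RaReConvertible s t

/-- The laws of an operational-probabilistic theory, including finiteness, closure and convexity.
The laws of sequential and parallel composition are those of the symmetric monoidal category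
`C`, and they are (bi)linear for the sum of transformations. -/
structure IsOPT [SymmetricCategory C] [MonoidalPreadditive C] [MonoidalLinear ℝ C] : Prop where
  id_channel : ∀ A : C, T.IsChannel (𝟙 A)
  associator_channel : ∀ A B D : C, T.IsChannel (α_ A B D).hom ∧ T.IsChannel (α_ A B D).inv
  leftUnitor_channel : ∀ A : C, T.IsChannel (λ_ A).hom ∧ T.IsChannel (λ_ A).inv
  rightUnitor_channel : ∀ A : C, T.IsChannel (ρ_ A).hom ∧ T.IsChannel (ρ_ A).inv
  swap_channel : ∀ A B : C, T.IsChannel (β_ A B).hom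
  comp_test : ∀ (A B D : C) (X Y : Type) [Fintype X] [Fintype Y] (f : X → (A ⟶ B))
    (g : Y → (B ⟶ D)), T.IsTest f → T.IsTest g → T.IsTest (fun x : X × Y => f x.1 ≫ g x.2)
  tensor_test : ∀ (A B D E : C) (X Y : Type) [Fintype X] [Fintype Y] (f : X → (A ⟶ B))
    (g : Y → (D ⟶ E)), T.IsTest f → T.IsTest g → T.IsTest (fun x : X × Y => f x.1 ⊗ₘ g x.2)
  coarse_test : ∀ (A B : C) (X Y : Type) [Fintype X] [Fintype Y] (c : X → (A ⟶ B))
    (d : Y → (A ⟶ B)) (r : Y → X), T.IsTest d → IsCoarseGraining c d r → T.IsTest c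
  /-- A closed test yields a probability distribution. -/
  prob_nonneg : ∀ s : 𝟙_ C ⟶ 𝟙_ C, T.IsTransf s → 0 ≤ T.prob s
  prob_sum : ∀ (X : Type) [Fintype X] (s : X → (𝟙_ C ⟶ 𝟙_ C)), T.IsTest s →
    ∑ x, T.prob (s x) = 1
  /-- Scalars are numbers: they compose by multiplication and act by multiplication. -/
  prob_comp : ∀ s t : 𝟙_ C ⟶ 𝟙_ C, T.IsTransf s → T.IsTransf t →
    T.prob (s ≫ t) = T.prob s * T.prob t
  prob_act : ∀ (A B : C) (s : 𝟙_ C ⟶ 𝟙_ C) (f : A ⟶ B), T.IsTransf s → T.IsTransf f →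
    (s ⊗ₘ f) ≫ (λ_ B).hom = (λ_ A).hom ≫ (T.prob s • f)
  /-- Transformations with the same statistics on all composite systems are equal. -/
  separation : ∀ (A B : C) (f g : A ⟶ B), T.IsTransf f → T.IsTransf g →
    (∀ (R : C) (s : 𝟙_ C ⟶ A ⊗ R) (a : B ⊗ R ⟶ 𝟙_ C), T.IsTransf s → T.IsTransf a →
      T.prob (s ≫ (f ▷ R) ≫ a) = T.prob (s ≫ (g ▷ R) ≫ a)) → f = g
  finite : ∀ A : C, FiniteDimensional ℝ (Submodule.span ℝ {s : 𝟙_ C ⟶ A | T.IsTransf s})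
  closed : ∀ (A B : C) (f : ℕ → (A ⟶ B)) (g : A ⟶ B), (∀ n, T.IsTransf (f n)) →
    g ∈ Submodule.span ℝ {h : A ⟶ B | T.IsTransf h} →
    (∀ (R : C) (s : 𝟙_ C ⟶ A ⊗ R) (a : B ⊗ R ⟶ 𝟙_ C), T.IsTransf s → T.IsTransf a →
      Filter.Tendsto (fun n => T.prob (s ≫ (f n ▷ R) ≫ a)) Filter.atTop
        (nhds (T.prob (s ≫ (g ▷ R) ≫ a)))) → T.IsTransf g
  convex : ∀ A B : C, Convex ℝ {f : A ⟶ B | T.IsTransf f}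

end Laws

end OPData

/-! ## Doubled Quantum Theory: systems and linear maps -/

/-- A basis with parities.  The Hilbert space is `ℂ^ι`; the sector `H₀` (respectively `H₁`) is
spanned by the basis vectors of parity `0` (respectively `1`).  Either the two sectors are
isomorphic and non-zero, or the system is trivial: one-dimensional and of even parity. -/
structure DoubledSystem : Type 1 where
  ι : Type
  [fintype : Fintype ι]
  [decEq : DecidableEq ι]
  parity : ι → ZMod 2
  shape : (Nonempty ι ∧ Nonempty ({i // parity i = 0} ≃ {i // parity i = 1})) ∨
    (Nonempty (Unique ι) ∧ ∀ i, parity i = 0)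

namespace DoubledSystem

attribute [instance] fintype decEq

/-- Operators on the Hilbert space of the system. -/
abbrev Op (A : DoubledSystem) : Type := Matrix A.ι A.ι ℂ

/-- The trivial system. -/
def trivialSystem : DoubledSystem where
  ι := Unit
  parity := fun _ => 0
  shape := Or.inr ⟨⟨inferInstance⟩, fun _ => rfl⟩

/-- Two sectors are isomorphic iff some permutation of the basis exchanges the parities. -/
theorem exchange_iff {ι : Type} [Fintype ι] (p : ι → ZMod 2) :
    Nonempty ({i // p i = 0} ≃ {i // p i = 1}) ↔ ∃ e : ι ≃ ι, ∀ i, p (e i) = p i + 1 := by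
  classical
  have h2 : ∀ z : ZMod 2, z ≠ 0 ↔ z = 1 := by decide
  constructor
  · rintro ⟨e⟩
    have e1 : {i // ¬ p i = 0} ≃ {i // p i = 1} :=
      Equiv.subtypeEquivRight fun i => h2 (p i)
    let e' : {i // ¬ p i = 0} ≃ {i // p i = 0} := e1.trans e.symm
    let s : {i // p i = 0} ⊕ {i // ¬ p i = 0} ≃ {i // p i = 0} ⊕ {i // ¬ p i = 0} :=
      (Equiv.sumComm _ _).trans (Equiv.sumCongr e' e'.symm)
    refine ⟨((Equiv.sumCompl (fun i => p i = 0)).symm.trans s).trans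
      (Equiv.sumCompl (fun i => p i = 0)), fun i => ?_⟩
    by_cases h : p i = 0
    · have hx := (h2 _).1 (e'.symm ⟨i, h⟩).2
      simp [s, Equiv.sumCompl_symm_apply_of_pos (p := fun i => p i = 0) h, h, hx]
    · have hx := (e' ⟨i, h⟩).2
      have h1 := (h2 _).1 h
      simp only [Equiv.trans_apply, s, Equiv.sumCompl_symm_apply_of_neg (p := fun i => p i = 0) h]
      simp only [Equiv.sumComm_apply, Sum.swap_inr, Equiv.sumCongr_apply, Sum.map_inl,
        Equiv.sumCompl_apply_inl, hx, h1]
      decide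
  · rintro ⟨e, he⟩
    refine ⟨e.subtypeEquiv fun i => ?_⟩
    rw [he]
    generalize p i = z
    revert z
    decide

/-- The composite system: parities add, so that the even sector is
`(H₀ ⊗ K₀) ⊕ (H₁ ⊗ K₁)` and the odd sector is `(H₀ ⊗ K₁) ⊕ (H₁ ⊗ K₀)`. -/
def tensor (A B : DoubledSystem) : DoubledSystem where
  ι := A.ι × B.ι
  parity := fun x => A.parity x.1 + B.parity x.2
  shape := by
    rcases A.shape with ⟨⟨a⟩, hA⟩ | ⟨⟨uA⟩, hA⟩
    · left
      have hB : Nonempty B.ι := by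
        rcases B.shape with ⟨h, -⟩ | ⟨⟨u⟩, -⟩
        · exact h
        · exact ⟨u.default⟩
      refine ⟨⟨(a, hB.some)⟩, (exchange_iff _).2 ?_⟩
      obtain ⟨e, he⟩ := (exchange_iff _).1 hA
      exact ⟨Equiv.prodCongr e (Equiv.refl _), fun x => by simp [he]; ring⟩
    · rcases B.shape with ⟨⟨b⟩, hB⟩ | ⟨⟨uB⟩, hB⟩
      · left
        refine ⟨⟨(uA.default, b)⟩, (exchange_iff _).2 ?_⟩
        obtain ⟨e, he⟩ := (exchange_iff _).1 hB
        exact ⟨Equiv.prodCongr (Equiv.refl _) e, fun x => by simp [he]; ring⟩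
      · right
        exact ⟨⟨⟨⟨(uA.default, uB.default)⟩, fun x =>
          Prod.ext (uA.uniq x.1) (uB.uniq x.2)⟩⟩, fun x => by simp [hA, hB]⟩

end DoubledSystem

/-- The parallel composition of linear maps on matrices:
`tensorMap F G (x ⊗ₖ y) = F x ⊗ₖ G y`. -/
noncomputable def tensorMap {a b c d : Type} [Fintype a] [DecidableEq a] [Fintype b]
    [DecidableEq b] [Fintype c] [DecidableEq c] [Fintype d] [DecidableEq d]
    (F : Matrix a a ℂ →ₗ[ℂ] Matrix b b ℂ) (G : Matrix c c ℂ →ₗ[ℂ] Matrix d d ℂ) :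
    Matrix (a × c) (a × c) ℂ →ₗ[ℂ] Matrix (b × d) (b × d) ℂ :=
  (kroneckerLinearEquiv b b d d ℂ).toLinearMap ∘ₗ TensorProduct.map F G ∘ₗ
    (kroneckerLinearEquiv a a c c ℂ).symm.toLinearMap

section TensorMap

variable {a b c d e f : Type} [Fintype a] [DecidableEq a] [Fintype b]
    [DecidableEq b] [Fintype c] [DecidableEq c] [Fintype d] [DecidableEq d]
    [Fintype e] [DecidableEq e] [Fintype f] [DecidableEq f]

theorem tensorMap_kronecker (F : Matrix a a ℂ →ₗ[ℂ] Matrix b b ℂ)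
    (G : Matrix c c ℂ →ₗ[ℂ] Matrix d d ℂ) (x : Matrix a a ℂ) (y : Matrix c c ℂ) :
    tensorMap F G (x ⊗ₖ y) = F x ⊗ₖ G y := by
  simp [tensorMap]

theorem kronecker_ext {V : Type*} [AddCommGroup V] [Module ℂ V]
    {F G : Matrix (a × c) (a × c) ℂ →ₗ[ℂ] V}
    (h : ∀ (x : Matrix a a ℂ) (y : Matrix c c ℂ), F (x ⊗ₖ y) = G (x ⊗ₖ y)) : F = G := by
  have h1 : F ∘ₗ (kroneckerLinearEquiv a a c c ℂ).toLinearMap =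
      G ∘ₗ (kroneckerLinearEquiv a a c c ℂ).toLinearMap := by
    apply TensorProduct.ext'
    intro x y
    simpa using h x y
  ext1 X
  have := LinearMap.congr_fun h1 ((kroneckerLinearEquiv a a c c ℂ).symm X)
  simpa using this

theorem kronecker_ext₃ {V : Type*} [AddCommGroup V] [Module ℂ V]
    {F G : Matrix ((a × b) × c) ((a × b) × c) ℂ →ₗ[ℂ] V}
    (h : ∀ (x : Matrix a a ℂ) (y : Matrix b b ℂ) (z : Matrix c c ℂ),
      F ((x ⊗ₖ y) ⊗ₖ z) = G ((x ⊗ₖ y) ⊗ₖ z)) : F = G := by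
  apply kronecker_ext
  intro X z
  let K := (kroneckerBilinear (R := ℂ) (l := a × b) (m := a × b) (n := c) (p := c) (α := ℂ)).flip z
  have h1 : F ∘ₗ K = G ∘ₗ K := by
    apply kronecker_ext
    intro x y
    exact h x y z
  exact LinearMap.congr_fun h1 X

/-- Relabelling the basis by a bijection, as a linear map on operators. -/
def relabel {a b : Type} (e : a ≃ b) : Matrix a a ℂ →ₗ[ℂ] Matrix b b ℂ :=
  (reindexLinearEquiv ℂ ℂ e e).toLinearMap

theorem relabel_apply {a b : Type} (e : a ≃ b) (X : Matrix a a ℂ) (i j : b) :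
    relabel e X i j = X (e.symm i) (e.symm j) := rfl

theorem relabel_comp {a b c : Type} (e : a ≃ b) (e' : b ≃ c) :
    relabel e' ∘ₗ relabel e = relabel (e.trans e') := rfl

theorem relabel_refl (a : Type) : relabel (Equiv.refl a) = LinearMap.id := rfl

theorem tensorMap_relabel (u : a ≃ b) (v : c ≃ d) :
    tensorMap (relabel u) (relabel v) = relabel (Equiv.prodCongr u v) := by
  refine kronecker_ext fun x y => ?_
  rw [tensorMap_kronecker]
  rfl

theorem tensorMap_id : tensorMap (LinearMap.id : Matrix a a ℂ →ₗ[ℂ] Matrix a a ℂ)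
    (LinearMap.id : Matrix c c ℂ →ₗ[ℂ] Matrix c c ℂ) = LinearMap.id :=
  kronecker_ext fun _ _ => tensorMap_kronecker _ _ _ _

theorem tensorMap_comp (F : Matrix a a ℂ →ₗ[ℂ] Matrix b b ℂ)
    (G : Matrix c c ℂ →ₗ[ℂ] Matrix d d ℂ) (F' : Matrix b b ℂ →ₗ[ℂ] Matrix e e ℂ)
    (G' : Matrix d d ℂ →ₗ[ℂ] Matrix f f ℂ) :
    tensorMap F' G' ∘ₗ tensorMap F G = tensorMap (F' ∘ₗ F) (G' ∘ₗ G) :=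
  kronecker_ext fun x y => by simp [tensorMap_kronecker]

theorem tensorMap_assoc (F : Matrix a a ℂ →ₗ[ℂ] Matrix b b ℂ)
    (G : Matrix c c ℂ →ₗ[ℂ] Matrix d d ℂ) (H : Matrix e e ℂ →ₗ[ℂ] Matrix f f ℂ) :
    relabel (Equiv.prodAssoc b d f) ∘ₗ tensorMap (tensorMap F G) H =
      tensorMap F (tensorMap G H) ∘ₗ relabel (Equiv.prodAssoc a c e) := by
  refine kronecker_ext₃ fun x y z => ?_
  have h : relabel (Equiv.prodAssoc a c e) ((x ⊗ₖ y) ⊗ₖ z) = x ⊗ₖ (y ⊗ₖ z) :=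
    kronecker_assoc _ _ _
  simp only [LinearMap.comp_apply, h, tensorMap_kronecker]
  exact kronecker_assoc _ _ _

theorem tensorMap_leftUnit (F : Matrix a a ℂ →ₗ[ℂ] Matrix b b ℂ) :
    relabel (Equiv.punitProd b) ∘ₗ
        tensorMap (LinearMap.id : Matrix PUnit PUnit ℂ →ₗ[ℂ] Matrix PUnit PUnit ℂ) F =
      F ∘ₗ relabel (Equiv.punitProd a) := by
  have h : ∀ {g : Type} (w : Matrix g g ℂ) (x : Matrix PUnit PUnit ℂ),
      relabel (Equiv.punitProd g) (x ⊗ₖ w) = x ⟨⟩ ⟨⟩ • w := by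
    intro g w x; ext i j; rfl
  refine kronecker_ext fun x y => ?_
  simp only [LinearMap.comp_apply, tensorMap_kronecker, h, map_smul, LinearMap.id_apply]

theorem tensorMap_rightUnit (F : Matrix a a ℂ →ₗ[ℂ] Matrix b b ℂ) :
    relabel (Equiv.prodPUnit b) ∘ₗ
        tensorMap F (LinearMap.id : Matrix PUnit PUnit ℂ →ₗ[ℂ] Matrix PUnit PUnit ℂ) =
      F ∘ₗ relabel (Equiv.prodPUnit a) := by
  have h : ∀ {g : Type} (w : Matrix g g ℂ) (x : Matrix PUnit PUnit ℂ),
      relabel (Equiv.prodPUnit g) (w ⊗ₖ x) = x ⟨⟩ ⟨⟩ • w := by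
    intro g w x; ext i j; exact mul_comm _ _
  refine kronecker_ext fun x y => ?_
  simp only [LinearMap.comp_apply, tensorMap_kronecker, h, map_smul, LinearMap.id_apply]

theorem tensorMap_swap (F : Matrix a a ℂ →ₗ[ℂ] Matrix b b ℂ)
    (G : Matrix c c ℂ →ₗ[ℂ] Matrix d d ℂ) :
    relabel (Equiv.prodComm b d) ∘ₗ tensorMap F G =
      tensorMap G F ∘ₗ relabel (Equiv.prodComm a c) := by
  have h : ∀ {g k : Type} (x : Matrix g g ℂ) (y : Matrix k k ℂ),
      relabel (Equiv.prodComm g k) (x ⊗ₖ y) = y ⊗ₖ x := by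
    intro g k x y; ext i j; exact mul_comm _ _
  refine kronecker_ext fun x y => ?_
  simp only [LinearMap.comp_apply, tensorMap_kronecker, h]

theorem tensorMap_add_left (F F' : Matrix a a ℂ →ₗ[ℂ] Matrix b b ℂ)
    (G : Matrix c c ℂ →ₗ[ℂ] Matrix d d ℂ) :
    tensorMap (F + F') G = tensorMap F G + tensorMap F' G :=
  kronecker_ext fun x y => by simp [tensorMap_kronecker, add_kronecker]

theorem tensorMap_add_right (F : Matrix a a ℂ →ₗ[ℂ] Matrix b b ℂ)
    (G G' : Matrix c c ℂ →ₗ[ℂ] Matrix d d ℂ) :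
    tensorMap F (G + G') = tensorMap F G + tensorMap F G' :=
  kronecker_ext fun x y => by simp [tensorMap_kronecker, kronecker_add]

theorem tensorMap_smul_left (r : ℝ) (F : Matrix a a ℂ →ₗ[ℂ] Matrix b b ℂ)
    (G : Matrix c c ℂ →ₗ[ℂ] Matrix d d ℂ) :
    tensorMap (r • F) G = r • tensorMap F G :=
  kronecker_ext fun x y => by simp [tensorMap_kronecker, smul_kronecker]

theorem tensorMap_smul_right (r : ℝ) (F : Matrix a a ℂ →ₗ[ℂ] Matrix b b ℂ)
    (G : Matrix c c ℂ →ₗ[ℂ] Matrix d d ℂ) :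
    tensorMap F (r • G) = r • tensorMap F G :=
  kronecker_ext fun x y => by simp [tensorMap_kronecker, kronecker_smul]

end TensorMap

namespace DoubledSystem

/-- Arrows from `A` to `B`: linear maps from the operators of `A` to the operators of `B`. -/
instance : Category.{0} DoubledSystem where
  Hom A B := A.Op →ₗ[ℂ] B.Op
  id _ := LinearMap.id
  comp F G := G ∘ₗ F

/-- The linear map underlying an arrow. -/
def toMap {A B : DoubledSystem} (F : A ⟶ B) : A.Op →ₗ[ℂ] B.Op := F

/-- A linear map regarded as an arrow. -/
def ofMap {A B : DoubledSystem} (F : A.Op →ₗ[ℂ] B.Op) : A ⟶ B := F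

/-- Relabelling of bases, as an isomorphism. -/
def relabelIso {A B : DoubledSystem} (e : A.ι ≃ B.ι) : A ≅ B where
  hom := ofMap (relabel e)
  inv := ofMap (relabel e.symm)
  hom_inv_id := (relabel_comp e e.symm).trans
    ((congrArg relabel e.self_trans_symm).trans (relabel_refl A.ι))
  inv_hom_id := (relabel_comp e.symm e).trans
    ((congrArg relabel e.symm_trans_self).trans (relabel_refl B.ι))

noncomputable instance : MonoidalCategoryStruct DoubledSystem where
  tensorObj := tensor
  tensorUnit := trivialSystem
  tensorHom F G := ofMap (tensorMap (toMap F) (toMap G))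
  whiskerLeft _ _ _ G := ofMap (tensorMap LinearMap.id (toMap G))
  whiskerRight F _ := ofMap (tensorMap (toMap F) LinearMap.id)
  associator A B D := relabelIso (A := tensor (tensor A B) D) (B := tensor A (tensor B D))
    (Equiv.prodAssoc A.ι B.ι D.ι)
  leftUnitor A := relabelIso (A := tensor trivialSystem A) (Equiv.punitProd A.ι)
  rightUnitor A := relabelIso (A := tensor A trivialSystem) (Equiv.prodPUnit A.ι)

noncomputable instance : MonoidalCategory DoubledSystem :=
  MonoidalCategory.ofTensorHom
    (id_tensorHom_id := fun _ _ => tensorMap_id)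
    (id_tensorHom := fun _ _ _ _ => rfl)
    (tensorHom_id := fun _ _ => rfl)
    (tensorHom_comp_tensorHom := fun F₁ F₂ G₁ G₂ => tensorMap_comp F₁ F₂ G₁ G₂)
    (associator_naturality := fun F₁ F₂ F₃ => tensorMap_assoc F₁ F₂ F₃)
    (leftUnitor_naturality := fun F => tensorMap_leftUnit F)
    (rightUnitor_naturality := fun F => tensorMap_rightUnit F)
    (pentagon := fun W X Y Z => by
      change (tensorMap (relabel (Equiv.refl W.ι)) (relabel (Equiv.prodAssoc X.ι Y.ι Z.ι)) ∘ₗ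
          relabel (Equiv.prodAssoc W.ι (X.ι × Y.ι) Z.ι)) ∘ₗ
          tensorMap (relabel (Equiv.prodAssoc W.ι X.ι Y.ι)) (relabel (Equiv.refl Z.ι)) =
        relabel (Equiv.prodAssoc W.ι X.ι (Y.ι × Z.ι)) ∘ₗ
          relabel (Equiv.prodAssoc (W.ι × X.ι) Y.ι Z.ι)
      simp only [tensorMap_relabel, relabel_comp]
      rfl)
    (triangle := fun X Y => by
      change tensorMap (relabel (Equiv.refl X.ι)) (relabel (Equiv.punitProd Y.ι)) ∘ₗ
          relabel (Equiv.prodAssoc X.ι Unit Y.ι) =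
        tensorMap (relabel (Equiv.prodPUnit X.ι)) (relabel (Equiv.refl Y.ι))
      simp only [tensorMap_relabel, relabel_comp]
      rfl)

noncomputable instance : SymmetricCategory DoubledSystem where
  braiding A B := relabelIso (A := tensor A B) (B := tensor B A) (Equiv.prodComm A.ι B.ι)
  braiding_naturality_right X _ _ F := tensorMap_swap (LinearMap.id : X.Op →ₗ[ℂ] X.Op) F
  braiding_naturality_left F Z := tensorMap_swap F (LinearMap.id : Z.Op →ₗ[ℂ] Z.Op)
  hexagon_forward X Y Z := by
    change (relabel (Equiv.prodAssoc Y.ι Z.ι X.ι) ∘ₗ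
        relabel (Equiv.prodComm X.ι (Y.ι × Z.ι))) ∘ₗ relabel (Equiv.prodAssoc X.ι Y.ι Z.ι) =
      (tensorMap (relabel (Equiv.refl Y.ι)) (relabel (Equiv.prodComm X.ι Z.ι)) ∘ₗ
        relabel (Equiv.prodAssoc Y.ι X.ι Z.ι)) ∘ₗ
        tensorMap (relabel (Equiv.prodComm X.ι Y.ι)) (relabel (Equiv.refl Z.ι))
    simp only [tensorMap_relabel, relabel_comp]
    rfl
  hexagon_reverse X Y Z := by
    change (relabel (Equiv.prodAssoc Z.ι X.ι Y.ι).symm ∘ₗ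
        relabel (Equiv.prodComm (X.ι × Y.ι) Z.ι)) ∘ₗ relabel (Equiv.prodAssoc X.ι Y.ι Z.ι).symm =
      (tensorMap (relabel (Equiv.prodComm X.ι Z.ι)) (relabel (Equiv.refl Y.ι)) ∘ₗ
        relabel (Equiv.prodAssoc X.ι Z.ι Y.ι).symm) ∘ₗ
        tensorMap (relabel (Equiv.refl X.ι)) (relabel (Equiv.prodComm Y.ι Z.ι))
    simp only [tensorMap_relabel, relabel_comp]
    rfl
  symmetry X Y := by
    change relabel (Equiv.prodComm Y.ι X.ι) ∘ₗ relabel (Equiv.prodComm X.ι Y.ι) = LinearMap.id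
    rfl

noncomputable instance : Preadditive DoubledSystem where
  homGroup A B := inferInstanceAs (AddCommGroup (A.Op →ₗ[ℂ] B.Op))
  add_comp _ _ _ F F' G := LinearMap.comp_add F F' G
  comp_add _ _ _ F G G' := LinearMap.add_comp F G' G

noncomputable instance : Linear ℝ DoubledSystem where
  homModule A B := inferInstanceAs (Module ℝ (A.Op →ₗ[ℂ] B.Op))
  smul_comp _ _ _ r F G := LinearMap.ext fun X => LinearMap.map_smul_of_tower G r (toMap F X)
  comp_smul _ _ _ _ _ _ := rfl

instance : MonoidalPreadditive DoubledSystem where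
  whiskerLeft_zero {X Y Z} := by
    have h := tensorMap_smul_right 0 (LinearMap.id : X.Op →ₗ[ℂ] X.Op) (0 : Y.Op →ₗ[ℂ] Z.Op)
    rw [zero_smul, zero_smul] at h
    exact h
  zero_whiskerRight {X Y Z} := by
    have h := tensorMap_smul_left 0 (0 : Y.Op →ₗ[ℂ] Z.Op) (LinearMap.id : X.Op →ₗ[ℂ] X.Op)
    rw [zero_smul, zero_smul] at h
    exact h
  whiskerLeft_add F G := tensorMap_add_right _ _ _
  add_whiskerRight F G := tensorMap_add_left _ _ _

instance : MonoidalLinear ℝ DoubledSystem where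
  whiskerLeft_smul _ _ _ _ _ := tensorMap_smul_right _ _ _
  smul_whiskerRight _ _ _ _ _ := tensorMap_smul_left _ _ _

end DoubledSystem

/-! ## Doubled Quantum Theory: states, tests and the doubled qubit -/

namespace DoubledSystem

/-- Block diagonal operators: no matrix elements between different parities. -/
def BlockDiagonal (A : DoubledSystem) (X : A.Op) : Prop :=
  ∀ i j, A.parity i ≠ A.parity j → X i j = 0

/-- Completely positive maps. -/
def CompletelyPositive {A B : DoubledSystem} (F : A ⟶ B) : Prop :=
  ∀ (n : ℕ) (X : Matrix (A.ι × Fin n) (A.ι × Fin n) ℂ), X.PosSemidef →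
    (tensorMap (toMap F) (LinearMap.id : Matrix (Fin n) (Fin n) ℂ →ₗ[ℂ] _) X).PosSemidef

/-- Maps that send block diagonal operators to block diagonal operators, also when applied to one
part of a composite system. -/
def PreservesBlocks {A B : DoubledSystem} (F : A ⟶ B) : Prop :=
  ∀ (R : DoubledSystem) (X : (A ⊗ R).Op), (A ⊗ R).BlockDiagonal X →
    (B ⊗ R).BlockDiagonal (toMap (F ▷ R) X)

/-- Trace-preserving maps. -/
def TracePreserving {A B : DoubledSystem} (F : A ⟶ B) : Prop :=
  ∀ X : A.Op, (toMap F X).trace = X.trace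

end DoubledSystem

open DoubledSystem in
/-- Doubled Quantum Theory.  Tests are the quantum instruments made of quantum operations that
preserve block diagonal operators. -/
noncomputable def doubledQuantumTheory : OPData DoubledSystem where
  IsTest {_ _ X} _ t := (∀ x : X, CompletelyPositive (t x) ∧ PreservesBlocks (t x)) ∧
    TracePreserving (∑ x, t x)
  prob :=
    { toFun := fun s => ((toMap s (1 : Matrix Unit Unit ℂ) : Matrix Unit Unit ℂ) () ()).re
      map_add' := fun _ _ => rfl
      map_smul' := fun r s => by
        change (r • ((toMap s (1 : Matrix Unit Unit ℂ) : Matrix Unit Unit ℂ) () ())).re = _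
        simp }

namespace DoubledSystem

/-- The arrow from the trivial system to `A` that prepares the operator `M`. -/
def prepare {A : DoubledSystem} (M : A.Op) : 𝟙_ DoubledSystem ⟶ A :=
  ofMap (A := trivialSystem)
    { toFun := fun c => c () () • M
      map_add' := fun c d => add_smul (c () ()) (d () ()) M
      map_smul' := fun z c => mul_smul z (c () ()) M }

/-- The map `X ↦ U X Uᴴ`. -/
def conjugation {A : DoubledSystem} (U : A.Op) : A ⟶ A :=
  ofMap
    { toFun := fun X => U * X * Uᴴ
      map_add' := fun X Y => by rw [mul_add, add_mul]
      map_smul' := fun z X => by simp }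

/-- The unitary matrices of Doubled Quantum Theory: those whose conjugation maps block diagonal
operators to block diagonal operators. -/
def AllowedUnitary {A : DoubledSystem} (U : A.Op) : Prop :=
  U ∈ Matrix.unitaryGroup A.ι ℂ ∧ ∀ X : A.Op, A.BlockDiagonal X → A.BlockDiagonal (U * X * Uᴴ)

/-- The doubled qubit: the basis vector `|x,k⟩` is the `k`-th basis vector of the sector of
parity `x`. -/
def doubledQubit : DoubledSystem where
  ι := ZMod 2 × Fin 2
  parity := Prod.fst
  shape := Or.inl ⟨⟨(0, 0)⟩, (exchange_iff _).2
    ⟨Equiv.prodCongr (Equiv.addRight 1) (Equiv.refl _), fun _ => rfl⟩⟩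

/-- The operator `|x,k⟩⟨x,k|` of the doubled qubit. -/
def proj (x : ZMod 2) (k : Fin 2) : doubledQubit.Op :=
  Matrix.single (x, k) (x, k) (1 : ℂ)

/-- The density matrix `½ (|0,0⟩⟨0,0| + |0,1⟩⟨0,1|)`, supported in the even sector. -/
noncomputable def rhoQubit : doubledQubit.Op := (1 / 2 : ℂ) • (proj 0 0 + proj 0 1)

/-- The density matrix `½ |0,0⟩⟨0,0| ⊕ ½ |1,0⟩⟨1,0|`, split across both sectors. -/
noncomputable def sigmaQubit : doubledQubit.Op := (1 / 2 : ℂ) • (proj 0 0 + proj 1 0)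

end DoubledSystem

/-!
Under the Choi correspondence, the operations from `A` to `B` that respect the parity correspond to
the positive semidefinite operators on `B ⊗ A` that are block diagonal for the total parity
(`isOperation_iff_choi`). For the forward direction, a map that is well behaved on composites with
the doubled qubit must shift all matrix units `|i⟩⟨j|` consistently with the parity; for the
backward direction, the columns of a square root of the Choi operator, cut into their two sectors,
give Kraus operators of definite parity (`IsGraded.exists_kraus`). Closure of tests under sequential
and parallel composition follows from the Kraus form. Separation and closedness follow from the Choi
form: the maximally entangled state of `A ⊗ A` has total parity zero, so it is a state of the
theory and turns a transformation into its Choi operator (`exists_faithful_state`), and a block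
diagonal operator is positive as soon as it is so on vectors of each sector
(`posSemidef_of_inSector`).

A positive matrix below a matrix of rank one is proportional to it, so the pure transformations are
those with a single Kraus operator of definite parity (`isPure_kraus`, `IsPure.exists_kraus`). Such
operators are closed under products and Kronecker products, which is Purity Preservation. A pure
state of `A ⊗ B` is a coefficient matrix `V` of definite parity, with marginal `V Vᴴ`. A square root
of a block diagonal density matrix, with columns cut into sectors, purifies it. Two coefficient
matrices of equal parity with the same marginal differ by a unitary in each sector of `B`; if their
parities differ, exchanging the two isomorphic sectors of `B` reduces to that case
(`exists_unitary_hasParity`).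

If `F` has inverse `G` and `F = ∑ Hⱼ`, then `∑ G ≫ Hⱼ` is the identity, which is pure, so each `Hⱼ`
is proportional to `F`. Hence a reversible `F` is `X ↦ U X Uᴴ` with `U` of definite parity, and both
`F` and `G` decreasing the trace forces `U` to be unitary. Conversely an allowed unitary has
definite parity (`AllowedUnitary.exists_hasParity`): it preserves or exchanges the sectors.

Both density matrices of the doubled qubit satisfy `ρ² = ρ / 2`, and perfectly distinguishable
states have orthogonal density matrices, so all eigenvalue vectors consist of two entries `1/2` and
of zeros. Reversible transformations permute the sectors. Therefore random reversible channels map `ρ`,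
half the projector on a sector, to combinations of the sector projectors, and they preserve the
property of `σ` of having weight `1/2` in each sector; this rules out both conversions.
-/

/-! ### Positive semidefinite matrices -/

namespace Matrix

section PosSemidef

variable {n : Type} [Fintype n]

open scoped MatrixOrder in
theorem PosSemidef.exists_eq_mul_conjTranspose {M : Matrix n n ℂ} (hM : M.PosSemidef) :
    ∃ S : Matrix n n ℂ, M = S * Sᴴ := by
  classical
  obtain ⟨S, rfl⟩ := CStarAlgebra.nonneg_iff_eq_star_mul_self.mp hM.nonneg
  exact ⟨Sᴴ, by simp [star_eq_conjTranspose]⟩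

theorem PosSemidef.trace_mul_nonneg {M N : Matrix n n ℂ} (hM : M.PosSemidef)
    (hN : N.PosSemidef) : 0 ≤ (M * N).trace := by
  obtain ⟨S, rfl⟩ := hM.exists_eq_mul_conjTranspose
  rw [Matrix.mul_assoc, trace_mul_comm, Matrix.mul_assoc]
  have := (hN.conjTranspose_mul_mul_same S).trace_nonneg
  rwa [Matrix.mul_assoc] at this

/-- Two positive semidefinite matrices that are orthogonal for the trace form have product zero. -/
theorem PosSemidef.mul_eq_zero_of_trace {M N : Matrix n n ℂ} (hM : M.PosSemidef)
    (hN : N.PosSemidef) (h : (M * N).trace = 0) : M * N = 0 := by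
  obtain ⟨S, rfl⟩ := hM.exists_eq_mul_conjTranspose
  obtain ⟨T, rfl⟩ := hN.exists_eq_mul_conjTranspose
  have h1 : ((Sᴴ * T) * (Sᴴ * T)ᴴ).trace = 0 := by
    rw [← h, conjTranspose_mul, conjTranspose_conjTranspose, Matrix.mul_assoc S,
      trace_mul_comm S]
    simp only [Matrix.mul_assoc]
  have h2 : Sᴴ * T = 0 := trace_mul_conjTranspose_self_eq_zero_iff.1 h1
  calc S * Sᴴ * (T * Tᴴ) = S * (Sᴴ * T) * Tᴴ := by simp only [Matrix.mul_assoc]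
    _ = 0 := by rw [h2]; simp

omit [Fintype n] in
open scoped MatrixOrder in
theorem PosSemidef.eq_zero_of_neg {M : Matrix n n ℂ} (h : M.PosSemidef) (h' : (-M).PosSemidef) :
    M = 0 :=
  le_antisymm (by rw [Matrix.le_iff]; simpa using h') (by rw [Matrix.le_iff]; simpa using h)

theorem trace_vecMulVec_star_mul (v : n → ℂ) (M : Matrix n n ℂ) :
    (vecMulVec v (star v) * M).trace = star v ⬝ᵥ M *ᵥ v := by
  rw [vecMulVec_mul, trace_vecMulVec, dotProduct_mulVec, dotProduct_comm]

/-- A matrix is determined by its quadratic form. -/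
theorem eq_of_quadraticForm_eq {M N : Matrix n n ℂ}
    (h : ∀ v : n → ℂ, star v ⬝ᵥ M *ᵥ v = star v ⬝ᵥ N *ᵥ v) : M = N := by
  have key : ∀ D : Matrix n n ℂ, D.IsHermitian → (∀ v : n → ℂ, star v ⬝ᵥ D *ᵥ v = 0) → D = 0 := by
    intro D hD h0
    refine PosSemidef.eq_zero_of_neg (.of_dotProduct_mulVec_nonneg hD fun v => (h0 v).ge)
      (.of_dotProduct_mulVec_nonneg hD.neg fun v => ?_)
    rw [neg_mulVec, dotProduct_neg, h0, neg_zero]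
  have hadj : ∀ (D : Matrix n n ℂ) (v : n → ℂ), star v ⬝ᵥ Dᴴ *ᵥ v = star (star v ⬝ᵥ D *ᵥ v) := by
    intro D v
    rw [star_dotProduct, star_mulVec, dotProduct_mulVec, conjTranspose_conjTranspose]
  set D := M - N with hDdef
  have h0 : ∀ v : n → ℂ, star v ⬝ᵥ D *ᵥ v = 0 := fun v => by
    rw [hDdef, sub_mulVec, dotProduct_sub, h, sub_self]
  have h1 : D + Dᴴ = 0 := key _ (isHermitian_add_transpose_self D) fun v => by
    rw [add_mulVec, dotProduct_add, hadj, h0]; simp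
  have h2 : Complex.I • (D - Dᴴ) = 0 := key _ (by
      rw [IsHermitian, conjTranspose_smul, conjTranspose_sub, conjTranspose_conjTranspose]
      simp only [RCLike.star_def, Complex.conj_I, neg_smul, ← smul_neg, neg_sub]) fun v => by
    rw [smul_mulVec, sub_mulVec, dotProduct_smul, dotProduct_sub, hadj, h0]; simp
  have h3 : D = Dᴴ := sub_eq_zero.1 ((smul_eq_zero.1 h2).resolve_left Complex.I_ne_zero)
  rw [← h3, ← two_smul ℂ D] at h1
  exact sub_eq_zero.1 ((smul_eq_zero.1 h1).resolve_left two_ne_zero)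

/-- A positive semidefinite matrix dominated by a matrix of rank one is proportional to it. -/
theorem PosSemidef.eq_smul_of_le_vecMulVec {M : Matrix n n ℂ} {v : n → ℂ} (hM : M.PosSemidef)
    (h : (vecMulVec v (star v) - M).PosSemidef) :
    ∃ p : ℝ, 0 ≤ p ∧ M = (p : ℂ) • vecMulVec v (star v) := by
  classical
  by_cases hv : v = 0
  · subst hv
    refine ⟨0, le_rfl, ?_⟩
    have : M = 0 := PosSemidef.eq_zero_of_neg hM (by simpa using h)
    simp [this]
  have hs : star v ⬝ᵥ v ≠ 0 := by simpa using hv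
  -- `M` annihilates the orthogonal complement of `v`
  have h0 : ∀ w, star v ⬝ᵥ w = 0 → M *ᵥ w = 0 := by
    intro w hw
    rw [← hM.dotProduct_mulVec_zero_iff]
    refine le_antisymm ?_ (hM.dotProduct_mulVec_nonneg w)
    have := h.dotProduct_mulVec_nonneg w
    rw [sub_mulVec, dotProduct_sub, vecMulVec_mulVec, hw] at this
    simpa using this
  have h1 : ∀ w, M *ᵥ w = ((star v ⬝ᵥ w) / (star v ⬝ᵥ v)) • (M *ᵥ v) := by
    intro w
    have := h0 (w - ((star v ⬝ᵥ w) / (star v ⬝ᵥ v)) • v) (by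
      rw [dotProduct_sub, dotProduct_smul, smul_eq_mul, div_mul_cancel₀ _ hs, sub_self])
    rwa [mulVec_sub, mulVec_smul, sub_eq_zero] at this
  set z := star v ⬝ᵥ M *ᵥ v with hz
  have hz0 : 0 ≤ z := hM.dotProduct_mulVec_nonneg v
  have hs0 : 0 ≤ star v ⬝ᵥ v := dotProduct_star_self_nonneg v
  obtain ⟨s, hs'⟩ : ∃ s : ℝ, (s : ℂ) = star v ⬝ᵥ v :=
    ⟨(star v ⬝ᵥ v).re, (Complex.eq_re_of_ofReal_le hs0).symm⟩
  obtain ⟨t, ht⟩ : ∃ t : ℝ, (t : ℂ) = z := ⟨z.re, (Complex.eq_re_of_ofReal_le hz0).symm⟩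
  refine ⟨t / s ^ 2, div_nonneg ?_ (sq_nonneg _), ?_⟩
  · rw [← ht] at hz0; exact_mod_cast hz0
  refine eq_of_quadraticForm_eq fun w => ?_
  have hsym : star w ⬝ᵥ M *ᵥ v = star (star v ⬝ᵥ M *ᵥ w) := by
    conv_lhs => rw [← hM.isHermitian.eq]
    rw [star_dotProduct, star_mulVec, dotProduct_mulVec, conjTranspose_conjTranspose]
  have hs1 : star (star v ⬝ᵥ v) = star v ⬝ᵥ v := by rw [← hs']; simp
  have hz1 : star z = z := by rw [← ht]; simp
  rw [h1 w, dotProduct_smul, hsym, h1 w, dotProduct_smul, smul_mulVec, dotProduct_smul,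
    vecMulVec_mulVec, ← hz]
  push_cast
  rw [ht, hs']
  have hw : star w ⬝ᵥ v = star (star v ⬝ᵥ w) := by
    rw [star_dotProduct]
  simp only [smul_eq_mul, star_mul', star_div₀, hs1, hz1, dotProduct_smul, hw,
    MulOpposite.smul_eq_mul_unop, MulOpposite.unop_op]
  field_simp

end PosSemidef

/-- Two matrices with the same Gram matrix of rows differ by a unitary factor on the right. -/
theorem exists_unitary_of_mul_conjTranspose_eq {m n : Type} [Fintype m] [Fintype n]
    [DecidableEq n] {K L : Matrix m n ℂ} (h : K * Kᴴ = L * Lᴴ) :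
    ∃ U ∈ unitaryGroup n ℂ, L = K * U := by
  classical
  -- the vectors `Kᴴ x` and `Lᴴ x` have equal norms, so `Kᴴ x ↦ Lᴴ x` is an isometry, which extends
  let f := toEuclideanLin Kᴴ
  let g := toEuclideanLin Lᴴ
  have hdot : ∀ (N : Matrix n m ℂ) (x : EuclideanSpace ℂ m),
      inner ℂ (toEuclideanLin N x) (toEuclideanLin N x) = star x.ofLp ⬝ᵥ (Nᴴ * N) *ᵥ x.ofLp := by
    intro N x
    rw [EuclideanSpace.inner_eq_star_dotProduct, ofLp_toLpLin, toLin'_apply, star_mulVec,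
      dotProduct_comm, ← dotProduct_mulVec, mulVec_mulVec]
  have hnorm : ∀ x, ‖g x‖ = ‖f x‖ := by
    intro x
    have h1 : inner ℂ (g x) (g x) = inner ℂ (f x) (f x) := by
      rw [hdot, hdot, conjTranspose_conjTranspose, conjTranspose_conjTranspose, h]
    rw [@norm_eq_sqrt_re_inner ℂ, @norm_eq_sqrt_re_inner ℂ, h1]
  have hker : f.ker ≤ g.ker := fun x hx => by
    rw [LinearMap.mem_ker, ← norm_eq_zero] at hx ⊢
    rw [hnorm, hx]
  let V : f.range →ₗᵢ[ℂ] EuclideanSpace ℂ n :=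
    { toLinearMap := f.ker.liftQ g hker ∘ₗ f.quotKerEquivRange.symm.toLinearMap
      norm_map' := by
        rintro ⟨_, x, rfl⟩
        have : f.quotKerEquivRange.symm ⟨f x, x, rfl⟩ = f.ker.mkQ x := by
          rw [LinearEquiv.symm_apply_eq]; rfl
        simp only [LinearMap.comp_apply, LinearEquiv.coe_coe, this]
        exact hnorm x }
  have hV : ∀ x, V.extend (f x) = g x := by
    intro x
    have := V.extend_apply ⟨f x, x, rfl⟩
    rw [this]
    change f.ker.liftQ g hker (f.quotKerEquivRange.symm ⟨f x, x, rfl⟩) = g x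
    have : f.quotKerEquivRange.symm ⟨f x, x, rfl⟩ = f.ker.mkQ x := by
      rw [LinearEquiv.symm_apply_eq]; rfl
    rw [this]; rfl
  obtain ⟨W, hW⟩ := (toEuclideanLin (𝕜 := ℂ) (m := n) (n := n)).surjective V.extend.toLinearMap
  have hWu : Wᴴ * W = 1 := by
    refine eq_of_quadraticForm_eq fun v => ?_
    have h1 : inner ℂ (toEuclideanLin W (WithLp.toLp 2 v)) (toEuclideanLin W (WithLp.toLp 2 v)) =
        inner ℂ (WithLp.toLp 2 v) (WithLp.toLp 2 v) := by
      rw [hW]; exact V.extend.inner_map_map _ _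
    rw [EuclideanSpace.inner_eq_star_dotProduct, ofLp_toLpLin, toLin'_apply, star_mulVec,
      dotProduct_comm, ← dotProduct_mulVec, mulVec_mulVec,
      EuclideanSpace.inner_eq_star_dotProduct, dotProduct_comm] at h1
    simpa [dotProduct_comm (star v)] using h1
  have hWK : W * Kᴴ = Lᴴ := by
    apply (toEuclideanLin (𝕜 := ℂ) (m := n) (n := m)).injective
    ext1 x
    change _ = g x
    rw [← hV]
    change _ = V.extend.toLinearMap (f x)
    rw [← hW]
    apply (WithLp.ofLp_injective 2)
    simp [f, mulVec_mulVec]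
  refine ⟨Wᴴ, mem_unitaryGroup_iff.2 ?_, ?_⟩
  · simpa [star_eq_conjTranspose] using hWu
  · have := congrArg conjTranspose hWK
    simpa using this.symm

end Matrix

/-! ### Kraus operators and Choi matrices -/

section Choi

variable {a b c d : Type} [Fintype a] [DecidableEq a] [Fintype b] [DecidableEq b]
  [Fintype c] [DecidableEq c] [Fintype d] [DecidableEq d]

/-- The map `X ↦ K X Kᴴ` with the single Kraus operator `K`. -/
def krausMap (K : Matrix b a ℂ) : Matrix a a ℂ →ₗ[ℂ] Matrix b b ℂ where
  toFun X := K * X * Kᴴ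
  map_add' X Y := by rw [Matrix.mul_add, Matrix.add_mul]
  map_smul' z X := by simp

omit [DecidableEq a] [Fintype b] [DecidableEq b] in
theorem krausMap_apply (K : Matrix b a ℂ) (X : Matrix a a ℂ) : krausMap K X = K * X * Kᴴ := rfl

omit [DecidableEq a] [DecidableEq b] [Fintype c] [DecidableEq c] in
theorem krausMap_comp (K : Matrix b a ℂ) (L : Matrix c b ℂ) :
    krausMap L ∘ₗ krausMap K = krausMap (L * K) := by
  ext1 X
  simp [krausMap_apply, Matrix.mul_assoc]

theorem tensorMap_krausMap (K : Matrix b a ℂ) (L : Matrix d c ℂ) :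
    tensorMap (krausMap K) (krausMap L) = krausMap (K ⊗ₖ L) := by
  refine kronecker_ext fun x y => ?_
  rw [tensorMap_kronecker]
  simp only [krausMap_apply, conjTranspose_kronecker, ← mul_kronecker_mul]

theorem krausMap_one : krausMap (1 : Matrix a a ℂ) = LinearMap.id := by
  ext1 X
  simp [krausMap_apply]

/-- The Choi matrix of a linear map: its entries are those of the images of the matrix units. -/
def choi (F : Matrix a a ℂ →ₗ[ℂ] Matrix b b ℂ) : Matrix (b × a) (b × a) ℂ :=
  of fun x y => F (single x.2 y.2 1) x.1 y.1

omit [Fintype a] [Fintype b] [DecidableEq b] in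
theorem choi_apply (F : Matrix a a ℂ →ₗ[ℂ] Matrix b b ℂ) (x y : b × a) :
    choi F x y = F (single x.2 y.2 1) x.1 y.1 := rfl

omit [Fintype b] [DecidableEq b] in
theorem apply_eq_sum_choi (F : Matrix a a ℂ →ₗ[ℂ] Matrix b b ℂ) (X : Matrix a a ℂ) (k l : b) :
    F X k l = ∑ i, ∑ j, X i j * choi F (k, i) (l, j) := by
  conv_lhs => rw [matrix_eq_sum_single X]
  simp only [map_sum, Matrix.sum_apply, choi_apply]
  refine Finset.sum_congr rfl fun i _ => Finset.sum_congr rfl fun j _ => ?_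
  rw [← mul_one (X i j), ← smul_eq_mul, ← smul_single, map_smul]
  simp

omit [Fintype b] [DecidableEq b] in
theorem choi_injective :
    Function.Injective (choi : (Matrix a a ℂ →ₗ[ℂ] Matrix b b ℂ) → _) := by
  intro F G h
  ext1 X
  ext k l
  rw [apply_eq_sum_choi, apply_eq_sum_choi, h]

omit [Fintype a] [Fintype b] [DecidableEq b] in
theorem choi_add (F G : Matrix a a ℂ →ₗ[ℂ] Matrix b b ℂ) : choi (F + G) = choi F + choi G := rfl

omit [Fintype a] [Fintype b] [DecidableEq b] in
theorem choi_sum {κ : Type} (s : Finset κ) (F : κ → (Matrix a a ℂ →ₗ[ℂ] Matrix b b ℂ)) :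
    choi (∑ k ∈ s, F k) = ∑ k ∈ s, choi (F k) := by
  ext x y
  simp [choi_apply, Matrix.sum_apply]

omit [Fintype a] [Fintype b] [DecidableEq b] in
theorem choi_smul (r : ℝ) (F : Matrix a a ℂ →ₗ[ℂ] Matrix b b ℂ) :
    choi (r • F) = (r : ℂ) • choi F := by
  ext x y
  simp [choi_apply]

omit [Fintype b] [DecidableEq b] in
/-- The Choi matrix of `X ↦ K X Kᴴ` is the projector on the entries of `K`, up to a factor. -/
theorem choi_krausMap (K : Matrix b a ℂ) :
    choi (krausMap K) = vecMulVec (fun x : b × a => K x.1 x.2) (star fun x => K x.1 x.2) := by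
  ext x y
  simp [choi_apply, krausMap_apply, vecMulVec_apply, Matrix.mul_apply, single_apply, ite_and]

/-- The Choi matrix of `F` is the image under `F ⊗ id` of the operator `∑ |ii⟩⟨jj|`. -/
theorem choi_eq_tensorMap (F : Matrix a a ℂ →ₗ[ℂ] Matrix b b ℂ) :
    choi F = tensorMap F LinearMap.id
      (vecMulVec (fun x : a × a => if x.1 = x.2 then (1 : ℂ) else 0)
        (star fun x : a × a => if x.1 = x.2 then (1 : ℂ) else 0)) := by
  have h : (vecMulVec (fun x : a × a => if x.1 = x.2 then (1 : ℂ) else 0)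
      (star fun x : a × a => if x.1 = x.2 then (1 : ℂ) else 0)) =
      ∑ i, ∑ j, single i j (1 : ℂ) ⊗ₖ single i j (1 : ℂ) := by
    ext ⟨x, y⟩ ⟨z, w⟩
    simp only [vecMulVec_apply, Matrix.sum_apply, kroneckerMap_apply, single_apply, Pi.star_apply]
    by_cases h1 : x = y <;> by_cases h2 : z = w
    · subst h1 h2; simp [ite_and]
    all_goals
      simp only [h1, h2, if_true, if_false, star_zero, mul_zero, zero_mul]
      symm
      refine Finset.sum_eq_zero fun i _ => Finset.sum_eq_zero fun j _ => ?_
      by_cases h3 : i = x <;> by_cases h4 : j = z <;> simp_all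
  rw [h]
  ext ⟨k, i⟩ ⟨l, j⟩
  simp [map_sum, tensorMap_kronecker, Matrix.sum_apply, single_apply, choi_apply, ite_and]

/-- The matrix `E` with `tr (F X) = tr (E X)`: the image of the identity under the dual map. -/
def dualUnit (F : Matrix a a ℂ →ₗ[ℂ] Matrix b b ℂ) : Matrix a a ℂ :=
  of fun i j => (F (single j i 1)).trace

omit [DecidableEq b] in
theorem trace_apply_eq (F : Matrix a a ℂ →ₗ[ℂ] Matrix b b ℂ) (X : Matrix a a ℂ) :
    (F X).trace = (dualUnit F * X).trace := by
  conv_lhs => rw [matrix_eq_sum_single X]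
  simp only [map_sum, trace_sum]
  rw [trace, Finset.sum_comm]
  refine Finset.sum_congr rfl fun i _ => ?_
  rw [diag_apply, Matrix.mul_apply]
  refine Finset.sum_congr rfl fun j _ => ?_
  rw [← mul_one (X j i), ← smul_eq_mul, ← smul_single, map_smul, trace_smul]
  simp [dualUnit, mul_comm]

omit [Fintype a] [DecidableEq b] in
theorem dualUnit_add (F G : Matrix a a ℂ →ₗ[ℂ] Matrix b b ℂ) :
    dualUnit (F + G) = dualUnit F + dualUnit G := by
  ext i j; simp [dualUnit]

omit [Fintype a] [DecidableEq b] in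
theorem dualUnit_sum {κ : Type} (s : Finset κ) (F : κ → (Matrix a a ℂ →ₗ[ℂ] Matrix b b ℂ)) :
    dualUnit (∑ k ∈ s, F k) = ∑ k ∈ s, dualUnit (F k) := by
  ext i j
  simp [dualUnit, Matrix.sum_apply, trace_sum]

omit [DecidableEq b] in
theorem eq_of_trace_mul_eq {M N : Matrix a a ℂ} (h : ∀ X, (M * X).trace = (N * X).trace) :
    M = N := by
  ext i j
  have := h (single j i 1)
  simpa [trace, Matrix.mul_apply, single_apply, ite_and] using this

omit [DecidableEq b] in
theorem dualUnit_krausMap (K : Matrix b a ℂ) : dualUnit (krausMap K) = Kᴴ * K := by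
  refine eq_of_trace_mul_eq fun X => ?_
  rw [← trace_apply_eq, krausMap_apply, Matrix.mul_assoc, trace_mul_comm, trace_mul_comm (Kᴴ * K),
    Matrix.mul_assoc]

omit [DecidableEq b] in
theorem tracePreserving_iff_dualUnit (F : Matrix a a ℂ →ₗ[ℂ] Matrix b b ℂ) :
    (∀ X, (F X).trace = X.trace) ↔ dualUnit F = 1 := by
  constructor
  · intro h
    refine eq_of_trace_mul_eq fun X => ?_
    rw [← trace_apply_eq, h, Matrix.one_mul]
  · intro h X
    rw [trace_apply_eq, h, Matrix.one_mul]

omit [Fintype a] [DecidableEq b] in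
theorem posSemidef_dualUnit {F : Matrix a a ℂ →ₗ[ℂ] Matrix b b ℂ} (hF : (choi F).PosSemidef) :
    (dualUnit F).PosSemidef := by
  have h : dualUnit F = (∑ k : b, (choi F).submatrix (fun i => (k, i)) (fun i => (k, i)))ᵀ := by
    ext i j
    simp [dualUnit, trace, Matrix.sum_apply, choi_apply]
  rw [h]
  exact (posSemidef_sum _ fun k _ => hF.submatrix _).transpose

end Choi

/-! ### Quantum operations that respect the parity -/

namespace DoubledSystem

variable {A B D E : DoubledSystem}

theorem nonempty_ι (A : DoubledSystem) : Nonempty A.ι := by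
  rcases A.shape with ⟨h, -⟩ | ⟨⟨u⟩, -⟩
  · exact h
  · exact ⟨u.default⟩

theorem toMap_sum {κ : Type} (s : Finset κ) (F : κ → (A ⟶ B)) :
    toMap (∑ j ∈ s, F j) = ∑ j ∈ s, toMap (F j) :=
  map_sum (AddMonoidHom.mk' (toMap : (A ⟶ B) → _) fun _ _ => rfl) F s

theorem toMap_add (F G : A ⟶ B) : toMap (F + G) = toMap F + toMap G := rfl

theorem toMap_comp (F : A ⟶ B) (G : B ⟶ D) (X : A.Op) :
    toMap (F ≫ G) X = toMap G (toMap F X) := rfl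

theorem hom_ext_choi {F G : A ⟶ B} (h : choi (toMap F) = choi (toMap G)) : F = G :=
  choi_injective h

/-- The arrow `X ↦ K X Kᴴ` with the single Kraus operator `K`. -/
def kraus (K : Matrix B.ι A.ι ℂ) : A ⟶ B := ofMap (krausMap K)

theorem toMap_kraus (K : Matrix B.ι A.ι ℂ) :
    toMap (kraus K : A ⟶ B) = krausMap K := rfl

theorem kraus_comp (K : Matrix B.ι A.ι ℂ) (L : Matrix D.ι B.ι ℂ) :
    (kraus K : A ⟶ B) ≫ (kraus L : B ⟶ D) = kraus (L * K) :=
  krausMap_comp K L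

theorem kraus_tensor (K : Matrix B.ι A.ι ℂ) (L : Matrix E.ι D.ι ℂ) :
    (kraus K : A ⟶ B) ⊗ₘ (kraus L : D ⟶ E) =
      (kraus (A := A ⊗ D) (B := B ⊗ E) (K ⊗ₖ L) : A ⊗ D ⟶ B ⊗ E) :=
  tensorMap_krausMap K L

theorem kraus_one : (kraus 1 : A ⟶ A) = 𝟙 A := krausMap_one

theorem kraus_zero : (kraus 0 : A ⟶ B) = 0 := by
  refine LinearMap.ext fun X => ?_
  change (0 : Matrix B.ι A.ι ℂ) * (X : A.Op) * (0 : Matrix B.ι A.ι ℂ)ᴴ = 0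
  rw [Matrix.zero_mul, Matrix.zero_mul]

theorem smul_kraus {r : ℝ} (hr : 0 ≤ r) (K : Matrix B.ι A.ι ℂ) :
    r • (kraus K : A ⟶ B) = kraus (((Real.sqrt r : ℝ) : ℂ) • K) := by
  refine LinearMap.ext fun X => ?_
  change r • (K * X * Kᴴ) = (((Real.sqrt r : ℝ) : ℂ) • K) * X * (((Real.sqrt r : ℝ) : ℂ) • K)ᴴ
  rw [conjTranspose_smul, smul_mul, smul_mul, Matrix.mul_smul, smul_smul]
  have : ((Real.sqrt r : ℝ) : ℂ) * star ((Real.sqrt r : ℝ) : ℂ) = (r : ℂ) := by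
    rw [RCLike.star_def, Complex.conj_ofReal, ← Complex.ofReal_mul, Real.mul_self_sqrt hr]
  rw [this]
  rfl

/-- The matrix `K` from `A` to `B` shifts the parity by `c`. -/
def HasParity (A B : DoubledSystem) (c : ZMod 2) (K : Matrix B.ι A.ι ℂ) : Prop :=
  ∀ k i, K k i ≠ 0 → B.parity k = A.parity i + c

theorem HasParity.mul {c c' : ZMod 2} {K : Matrix B.ι A.ι ℂ} {L : Matrix D.ι B.ι ℂ}
    (hK : HasParity A B c K) (hL : HasParity B D c' L) : HasParity A D (c + c') (L * K) := by
  intro k i h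
  obtain ⟨j, -, hj⟩ := Finset.exists_ne_zero_of_sum_ne_zero h
  rw [hL k j (left_ne_zero_of_mul hj), hK j i (right_ne_zero_of_mul hj), add_assoc]

theorem HasParity.kronecker {c c' : ZMod 2} {K : Matrix B.ι A.ι ℂ} {L : Matrix E.ι D.ι ℂ}
    (hK : HasParity A B c K) (hL : HasParity D E c' L) :
    HasParity (A ⊗ D) (B ⊗ E) (c + c') (K ⊗ₖ L) := by
  rintro ⟨k, l⟩ ⟨i, j⟩ h
  have h1 := hK k i (left_ne_zero_of_mul h)
  have h2 := hL l j (right_ne_zero_of_mul h)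
  change B.parity k + E.parity l = (A.parity i + D.parity j) + (c + c')
  rw [h1, h2]; ring

theorem HasParity.smul {c : ZMod 2} {K : Matrix B.ι A.ι ℂ} (hK : HasParity A B c K) (z : ℂ) :
    HasParity A B c (z • K) := fun k i h => hK k i (right_ne_zero_of_mul h)

theorem HasParity.one : HasParity A A 0 1 := by
  intro k i h
  by_cases hki : k = i
  · rw [hki, add_zero]
  · exact absurd (one_apply_ne hki) h

theorem HasParity.blockDiagonal {c : ZMod 2} {K : Matrix B.ι A.ι ℂ} (hK : HasParity A B c K)
    {X : A.Op} (hX : A.BlockDiagonal X) : B.BlockDiagonal (K * X * Kᴴ) := by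
  intro k l hkl
  rw [Matrix.mul_apply]
  refine Finset.sum_eq_zero fun j _ => ?_
  by_contra h
  obtain ⟨i, -, hi⟩ := Finset.exists_ne_zero_of_sum_ne_zero (left_ne_zero_of_mul h)
  have h1 := hK k i (left_ne_zero_of_mul hi)
  have h2 : K l j ≠ 0 := fun h0 => right_ne_zero_of_mul h (by simp [h0])
  have h3 : A.parity i = A.parity j := by
    by_contra h3
    exact right_ne_zero_of_mul hi (hX i j h3)
  exact hkl (by rw [h1, hK l j h2, h3])

/-- Quantum operations that preserve block diagonal operators: the possible members of tests,
before normalisation. -/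
def IsOperation (F : A ⟶ B) : Prop := CompletelyPositive F ∧ PreservesBlocks F

theorem isOperation_kraus {c : ZMod 2} {K : Matrix B.ι A.ι ℂ} (hK : HasParity A B c K) :
    IsOperation (kraus K : A ⟶ B) := by
  constructor
  · intro n X hX
    rw [toMap_kraus, ← krausMap_one, tensorMap_krausMap]
    exact hX.mul_mul_conjTranspose_same _
  · intro R X hX
    have h : (kraus K : A ⟶ B) ▷ R =
        kraus (A := A ⊗ R) (B := B ⊗ R) (K ⊗ₖ (1 : Matrix R.ι R.ι ℂ)) := by
      rw [← tensorHom_id, ← kraus_one, kraus_tensor]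
    rw [h]
    exact (hK.kronecker HasParity.one).blockDiagonal hX

theorem IsOperation.zero : IsOperation (0 : A ⟶ B) := by
  rw [← kraus_zero]
  exact isOperation_kraus (c := 0) fun _ _ h => absurd rfl h

theorem IsOperation.add {F G : A ⟶ B} (hF : IsOperation F) (hG : IsOperation G) :
    IsOperation (F + G) := by
  constructor
  · intro n X hX
    rw [toMap_add, tensorMap_add_left]
    exact (hF.1 n X hX).add (hG.1 n X hX)
  · intro R X hX i j hij
    rw [MonoidalPreadditive.add_whiskerRight]
    change toMap (F ▷ R) X i j + toMap (G ▷ R) X i j = 0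
    rw [hF.2 R X hX i j hij, hG.2 R X hX i j hij, add_zero]

theorem IsOperation.sum {κ : Type} (s : Finset κ) {F : κ → (A ⟶ B)}
    (h : ∀ j ∈ s, IsOperation (F j)) : IsOperation (∑ j ∈ s, F j) :=
  Finset.sum_induction F IsOperation (fun _ _ => IsOperation.add) IsOperation.zero h

/-- The Choi matrix of a completely positive map is positive semidefinite. -/
theorem CompletelyPositive.posSemidef_choi {F : A ⟶ B} (hF : CompletelyPositive F) :
    (choi (toMap F)).PosSemidef := by
  rw [choi_eq_tensorMap]
  set Ω := vecMulVec (fun x : A.ι × A.ι => if x.1 = x.2 then (1 : ℂ) else 0)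
        (star fun x : A.ι × A.ι => if x.1 = x.2 then (1 : ℂ) else 0) with hΩ
  have hpos : Ω.PosSemidef := posSemidef_vecMulVec_self_star _
  let e := Fintype.equivFin A.ι
  have h := hF _ (relabel (Equiv.prodCongr (Equiv.refl A.ι) e) Ω) (hpos.submatrix _)
  rw [← tensorMap_relabel, ← LinearMap.comp_apply, tensorMap_comp] at h
  have h2 : tensorMap (toMap F ∘ₗ relabel (Equiv.refl A.ι)) (LinearMap.id ∘ₗ relabel e) Ω =
      relabel (Equiv.prodCongr (Equiv.refl B.ι) e) (tensorMap (toMap F) LinearMap.id Ω) := by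
    rw [← tensorMap_relabel, ← LinearMap.comp_apply, tensorMap_comp]
    rfl
  rw [h2] at h
  exact (posSemidef_submatrix_equiv (Equiv.prodCongr (Equiv.refl B.ι) e).symm).1 h

/-- Block diagonality of the Choi matrix of a map, for the total parity. -/
def IsGraded (F : A ⟶ B) : Prop :=
  ∀ x y, B.parity x.1 + A.parity x.2 ≠ B.parity y.1 + A.parity y.2 → choi (toMap F) x y = 0

/-- A map that preserves block diagonality on composites with the doubled qubit is graded:
`|i⟩⟨j|` becomes block diagonal when tensored with a suitable operator `|r⟩⟨s|`. -/
theorem PreservesBlocks.isGraded {F : A ⟶ B} (hF : PreservesBlocks F) : IsGraded F := by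
  rintro ⟨k, i⟩ ⟨l, j⟩ h
  let r : doubledQubit.ι := (A.parity i, 0)
  let s : doubledQubit.ι := (A.parity j, 0)
  have h1 := hF doubledQubit (single i j (1 : ℂ) ⊗ₖ single r s (1 : ℂ)) (by
    rintro ⟨x, y⟩ ⟨z, w⟩ hxy
    rw [kroneckerMap_apply, single_apply, single_apply]
    by_cases h2 : i = x ∧ j = z
    · by_cases h3 : r = y ∧ s = w
      · refine absurd ?_ hxy
        obtain ⟨rfl, rfl⟩ := h2
        obtain ⟨rfl, rfl⟩ := h3
        change A.parity i + A.parity i = A.parity j + A.parity j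
        rw [CharTwo.add_self_eq_zero, CharTwo.add_self_eq_zero]
      · rw [if_neg h3, mul_zero]
    · rw [if_neg h2, zero_mul])
  have h2 := h1 (k, r) (l, s) h
  change tensorMap (toMap F) LinearMap.id _ _ _ = 0 at h2
  rw [tensorMap_kronecker] at h2
  simpa [choi_apply] using h2

/-- A map whose Choi matrix is positive semidefinite and block diagonal has Kraus operators of
definite parity, namely the parts of the columns of a square root of the Choi matrix. -/
theorem IsGraded.exists_kraus {F : A ⟶ B} (hF : IsGraded F)
    (hpos : (choi (toMap F)).PosSemidef) :
    ∃ (κ : Type) (_ : Fintype κ) (K : κ → Matrix B.ι A.ι ℂ),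
      (∀ j, ∃ c, HasParity A B c (K j)) ∧ F = ∑ j, kraus (K j) := by
  obtain ⟨S, hS⟩ := hpos.exists_eq_mul_conjTranspose
  refine ⟨ZMod 2 × (B.ι × A.ι), inferInstance, fun q => of fun k i =>
    if B.parity k = A.parity i + q.1 then S (k, i) q.2 else 0, fun q => ⟨q.1, fun k i h => ?_⟩, ?_⟩
  · by_contra h'
    exact h (if_neg h')
  · apply hom_ext_choi
    rw [toMap_sum, choi_sum]
    simp only [toMap_kraus, choi_krausMap]
    ext x y
    rw [Matrix.sum_apply, Fintype.sum_prod_type]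
    simp only [vecMulVec_apply, of_apply, Pi.star_apply]
    have hpar : ∀ (z : B.ι × A.ι) (c : ZMod 2),
        B.parity z.1 = A.parity z.2 + c ↔ c = B.parity z.1 + A.parity z.2 := by
      intro z c
      generalize B.parity z.1 = p
      generalize A.parity z.2 = q
      revert p q c
      decide
    simp only [hpar]
    rw [Finset.sum_eq_single (B.parity x.1 + A.parity x.2)]
    · by_cases hxy : B.parity x.1 + A.parity x.2 = B.parity y.1 + A.parity y.2
      · rw [hS, Matrix.mul_apply]
        simp [hxy]
      · rw [hF x y hxy]
        simp [hxy]
    · intro c _ hc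
      simp [hc]
    · simp

theorem isOperation_iff_choi {F : A ⟶ B} :
    IsOperation F ↔ (choi (toMap F)).PosSemidef ∧ IsGraded F := by
  refine ⟨fun h => ⟨h.1.posSemidef_choi, h.2.isGraded⟩, fun h => ?_⟩
  obtain ⟨κ, _, K, hK, rfl⟩ := h.2.exists_kraus h.1
  exact IsOperation.sum _ fun j _ => isOperation_kraus (hK j).choose_spec

theorem IsOperation.exists_kraus {F : A ⟶ B} (h : IsOperation F) :
    ∃ (κ : Type) (_ : Fintype κ) (K : κ → Matrix B.ι A.ι ℂ),
      (∀ j, ∃ c, HasParity A B c (K j)) ∧ F = ∑ j, kraus (K j) :=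
  (isOperation_iff_choi.1 h).2.exists_kraus (isOperation_iff_choi.1 h).1

theorem IsOperation.comp {F : A ⟶ B} {G : B ⟶ D} (hF : IsOperation F) (hG : IsOperation G) :
    IsOperation (F ≫ G) := by
  obtain ⟨κ, _, K, hK, rfl⟩ := hF.exists_kraus
  obtain ⟨μ, _, L, hL, rfl⟩ := hG.exists_kraus
  rw [Preadditive.sum_comp]
  refine IsOperation.sum _ fun j _ => ?_
  rw [Preadditive.comp_sum]
  refine IsOperation.sum _ fun l _ => ?_
  rw [kraus_comp]
  exact isOperation_kraus ((hK j).choose_spec.mul (hL l).choose_spec)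

theorem IsOperation.tensor {F : A ⟶ B} {G : D ⟶ E} (hF : IsOperation F) (hG : IsOperation G) :
    IsOperation (F ⊗ₘ G) := by
  obtain ⟨κ, _, K, hK, rfl⟩ := hF.exists_kraus
  obtain ⟨μ, _, L, hL, rfl⟩ := hG.exists_kraus
  rw [sum_tensor]
  refine IsOperation.sum _ fun j _ => ?_
  rw [tensor_sum]
  refine IsOperation.sum _ fun l _ => ?_
  rw [kraus_tensor]
  exact isOperation_kraus ((hK j).choose_spec.kronecker (hL l).choose_spec)

theorem IsOperation.isGraded {F : A ⟶ B} (h : IsOperation F) : IsGraded F := h.2.isGraded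

theorem IsOperation.posSemidef_choi {F : A ⟶ B} (h : IsOperation F) :
    (choi (toMap F)).PosSemidef := h.1.posSemidef_choi

/-! ### Transformations and tests -/

theorem tracePreserving_iff {F : A ⟶ B} : TracePreserving F ↔ dualUnit (toMap F) = 1 :=
  tracePreserving_iff_dualUnit _

theorem IsGraded.blockDiagonal_dualUnit {F : A ⟶ B} (h : IsGraded F) :
    A.BlockDiagonal (dualUnit (toMap F)) := by
  intro i j hij
  refine Finset.sum_eq_zero fun k _ => ?_
  exact h (k, j) (k, i) fun h => hij (add_left_cancel h).symm

theorem isTest_iff {X : Type} [Fintype X] {t : X → (A ⟶ B)} :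
    doubledQuantumTheory.IsTest t ↔ (∀ x, IsOperation (t x)) ∧ TracePreserving (∑ x, t x) := Iff.rfl

theorem isChannel_iff {F : A ⟶ B} :
    doubledQuantumTheory.IsChannel F ↔ IsOperation F ∧ TracePreserving F := by
  rw [OPData.IsChannel, isTest_iff]
  simp

/-- The transformations are the members of two-outcome tests. -/
theorem isTransf_iff_exists {F : A ⟶ B} : doubledQuantumTheory.IsTransf F ↔
    IsOperation F ∧ ∃ G : A ⟶ B, IsOperation G ∧ TracePreserving (F + G) := by
  classical
  constructor
  · rintro ⟨X, _, t, ht, x, rfl⟩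
    refine ⟨ht.1 x, ∑ y ∈ Finset.univ.erase x, t y, IsOperation.sum _ fun y _ => ht.1 y, ?_⟩
    rw [Finset.add_sum_erase _ _ (Finset.mem_univ x)]
    exact ht.2
  · rintro ⟨hF, G, hG, hFG⟩
    refine ⟨Bool, inferInstance, fun b => if b then F else G, ⟨?_, ?_⟩, true, rfl⟩
    · rintro (_ | _)
      · exact hG
      · exact hF
    · simpa using hFG

/-- The transformations are the operations that do not increase the trace. -/
theorem isTransf_iff {F : A ⟶ B} : doubledQuantumTheory.IsTransf F ↔
    IsOperation F ∧ (1 - dualUnit (toMap F)).PosSemidef := by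
  rw [isTransf_iff_exists]
  refine and_congr_right fun hF => ⟨?_, fun h => ?_⟩
  · rintro ⟨G, hG, hFG⟩
    rw [tracePreserving_iff, toMap_add, dualUnit_add] at hFG
    rw [← hFG, add_sub_cancel_left]
    exact posSemidef_dualUnit hG.posSemidef_choi
  -- the missing probability is carried by the operation `X ↦ tr ((1 - E) X) |k⟩⟨k|`
  · obtain ⟨k⟩ := B.nonempty_ι
    let N : A.Op := 1 - dualUnit (toMap F)
    let G : A ⟶ B := ofMap ((LinearMap.toSpanSingleton ℂ B.Op (single k k 1)) ∘ₗ
      traceLinearMap A.ι ℂ ℂ ∘ₗ LinearMap.mulLeft ℂ N)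
    have hGapp : ∀ X, toMap G X = (N * X).trace • single k k 1 := fun _ => rfl
    have htr : ∀ i j, (N * single i j (1 : ℂ)).trace = N j i := by
      intro i j
      simp [trace, Matrix.mul_apply, single_apply, ite_and]
    have hchoi : choi (toMap G) = single k k (1 : ℂ) ⊗ₖ Nᵀ := by
      ext x y
      rw [choi_apply, hGapp, htr]
      simp [mul_comm]
    refine ⟨G, isOperation_iff_choi.2 ⟨?_, ?_⟩, ?_⟩
    · rw [hchoi]
      refine PosSemidef.kronecker ?_ h.transpose
      have h1 : single k k (1 : ℂ) = vecMulVec (Pi.single k 1) (star (Pi.single k 1)) := by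
        rw [← Pi.single_star, star_one, single_eq_single_vecMulVec_single]
      rw [h1]
      exact posSemidef_vecMulVec_self_star _
    · intro x y hxy
      rw [hchoi, kroneckerMap_apply, single_apply]
      by_cases hk : k = x.1 ∧ k = y.1
      · obtain ⟨h1, h2⟩ := hk
        have h3 : A.parity y.2 ≠ A.parity x.2 := by
          rintro h3
          exact hxy (by rw [← h1, ← h2, h3])
        have h4 : N y.2 x.2 = 0 := by
          change (1 : A.Op) _ _ - _ = 0
          rw [hF.isGraded.blockDiagonal_dualUnit _ _ h3,
            one_apply_ne fun h => h3 (congrArg A.parity h), sub_zero]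
        rw [transpose_apply, h4, mul_zero]
      · rw [if_neg hk, zero_mul]
    · rw [tracePreserving_iff, toMap_add, dualUnit_add]
      have : dualUnit (toMap G) = N := by
        ext i j
        change (toMap G (single j i 1)).trace = _
        rw [hGapp, htr, trace_smul]
        simp
      rw [this]
      exact add_sub_cancel _ _

theorem IsChannel.isTransf {F : A ⟶ B} (h : doubledQuantumTheory.IsChannel F) :
    doubledQuantumTheory.IsTransf F := ⟨Unit, inferInstance, _, h, (), rfl⟩

theorem IsTransf.isOperation {F : A ⟶ B} (h : doubledQuantumTheory.IsTransf F) :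
    IsOperation F := (isTransf_iff.1 h).1

end DoubledSystem

/-! ### States, effects and vectors of definite parity -/

namespace DoubledSystem

variable {A B D E : DoubledSystem}

theorem IsOperation.smul {F : A ⟶ B} (hF : IsOperation F) {r : ℝ} (hr : 0 ≤ r) :
    IsOperation (r • F) := by
  obtain ⟨κ, _, K, hK, rfl⟩ := hF.exists_kraus
  rw [Finset.smul_sum]
  refine IsOperation.sum _ fun j _ => ?_
  rw [smul_kraus hr]
  exact isOperation_kraus ((hK j).choose_spec.smul _)

theorem toMap_smul (r : ℝ) (F : A ⟶ B) : toMap (r • F) = r • toMap F := rfl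

instance : Unique (𝟙_ DoubledSystem).ι := inferInstanceAs (Unique Unit)

/-- The operator prepared by a state. -/
noncomputable def density (s : 𝟙_ DoubledSystem ⟶ A) : A.Op := toMap s (1 : (𝟙_ DoubledSystem).Op)

theorem toMap_state (s : 𝟙_ DoubledSystem ⟶ A) (X : (𝟙_ DoubledSystem).Op) :
    toMap s X = X default default • density s := by
  have h : X = X default default • (1 : (𝟙_ DoubledSystem).Op) := by
    ext i j
    rw [Subsingleton.elim i default, Subsingleton.elim j default]
    simp
  conv_lhs => rw [h]
  exact map_smul (toMap s) _ _

theorem state_ext {s t : 𝟙_ DoubledSystem ⟶ A} (h : density s = density t) : s = t :=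
  LinearMap.ext fun X => by
    change toMap s X = toMap t X
    rw [toMap_state, toMap_state, h]

theorem density_prepare (M : A.Op) : density (prepare M) = M := one_smul ℂ M

theorem density_comp (s : 𝟙_ DoubledSystem ⟶ A) (F : A ⟶ B) :
    density (s ≫ F) = toMap F (density s) := rfl

theorem density_smul (r : ℝ) (s : 𝟙_ DoubledSystem ⟶ A) :
    density (r • s) = (r : ℂ) • density s := rfl

theorem density_sum {κ : Type} (S : Finset κ) (s : κ → (𝟙_ DoubledSystem ⟶ A)) :
    density (∑ j ∈ S, s j) = ∑ j ∈ S, density (s j) := by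
  rw [density, toMap_sum]
  exact LinearMap.sum_apply _ _ _

theorem prob_eq (s : 𝟙_ DoubledSystem ⟶ 𝟙_ DoubledSystem) :
    doubledQuantumTheory.prob s = ((density s) default default).re := rfl

theorem trace_unit (X : (𝟙_ DoubledSystem).Op) : X.trace = X default default := by
  simp [trace]

/-- The Born rule: the effect `a` occurs on the state `s` with probability `tr (E ρ)`. -/
theorem prob_comp_eq (s : 𝟙_ DoubledSystem ⟶ A) (a : A ⟶ 𝟙_ DoubledSystem) :
    doubledQuantumTheory.prob (s ≫ a) = (dualUnit (toMap a) * density s).trace.re := by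
  rw [← trace_apply_eq, prob_eq, density_comp, trace_unit]

theorem choi_state (s : 𝟙_ DoubledSystem ⟶ A) :
    choi (toMap s) = (density s).submatrix Prod.fst Prod.fst := by
  ext ⟨x, u⟩ ⟨y, w⟩
  rw [choi_apply, toMap_state, Subsingleton.elim u default, Subsingleton.elim w default]
  simp

theorem dualUnit_state (s : 𝟙_ DoubledSystem ⟶ A) :
    dualUnit (toMap s) = (density s).trace • (1 : (𝟙_ DoubledSystem).Op) := by
  ext u w
  rw [dualUnit, of_apply, toMap_state, Subsingleton.elim u default, Subsingleton.elim w default]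
  simp

theorem isOperation_state_iff {s : 𝟙_ DoubledSystem ⟶ A} :
    IsOperation s ↔ (density s).PosSemidef ∧ A.BlockDiagonal (density s) := by
  rw [isOperation_iff_choi, choi_state]
  refine and_congr ⟨fun h => ?_, fun h => h.submatrix _⟩ ⟨fun h i j hij => ?_, fun h x y hxy => ?_⟩
  · exact h.submatrix fun i => (i, default)
  · have := h (i, default) (j, default) (by simpa using hij)
    rwa [choi_state] at this
  · rw [choi_state]
    refine h _ _ fun h' => hxy (by rw [h', Subsingleton.elim x.2 y.2])

theorem posSemidef_smul_one_iff (z : ℂ) :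
    (1 - z • (1 : (𝟙_ DoubledSystem).Op)).PosSemidef ↔ z ≤ 1 := by
  have h : 1 - z • (1 : (𝟙_ DoubledSystem).Op) = diagonal fun _ => 1 - z := by
    ext i j
    rw [Subsingleton.elim i j]
    simp
  rw [h, posSemidef_diagonal_iff]
  simp

/-- States are the block diagonal positive operators of trace at most one. -/
theorem isTransf_state_iff {s : 𝟙_ DoubledSystem ⟶ A} : doubledQuantumTheory.IsTransf s ↔
    (density s).PosSemidef ∧ A.BlockDiagonal (density s) ∧ (density s).trace ≤ 1 := by
  rw [isTransf_iff, isOperation_state_iff, dualUnit_state, and_assoc]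
  exact and_congr_right fun _ => and_congr_right fun _ => posSemidef_smul_one_iff _

theorem isChannel_state_iff {s : 𝟙_ DoubledSystem ⟶ A} : doubledQuantumTheory.IsChannel s ↔
    (density s).PosSemidef ∧ A.BlockDiagonal (density s) ∧ (density s).trace = 1 := by
  rw [isChannel_iff, isOperation_state_iff, tracePreserving_iff, dualUnit_state, and_assoc]
  refine and_congr_right fun _ => and_congr_right fun _ => ⟨fun h => ?_, fun h => ?_⟩
  · have := congrFun (congrFun h default) default
    simpa using this
  · rw [h, one_smul]

/-- The vector `v` belongs to the sector of parity `c`. -/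
def InSector (A : DoubledSystem) (c : ZMod 2) (v : A.ι → ℂ) : Prop :=
  ∀ i, v i ≠ 0 → A.parity i = c

/-- The state with density matrix `|v⟩⟨v|`. -/
noncomputable def ket (v : A.ι → ℂ) : 𝟙_ DoubledSystem ⟶ A :=
  kraus (A := 𝟙_ DoubledSystem) (of fun i _ => v i)

/-- The effect `X ↦ ⟨v|X|v⟩`. -/
noncomputable def bra (v : A.ι → ℂ) : A ⟶ 𝟙_ DoubledSystem :=
  kraus (B := 𝟙_ DoubledSystem) (of fun _ i => star (v i))

theorem hasParity_ket {c : ZMod 2} {v : A.ι → ℂ} (hv : A.InSector c v) :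
    HasParity (𝟙_ DoubledSystem) A c (of fun i _ => v i) := fun i _ h =>
  (hv i h).trans (zero_add c).symm

theorem hasParity_bra {c : ZMod 2} {v : A.ι → ℂ} (hv : A.InSector c v) :
    HasParity A (𝟙_ DoubledSystem) c (of fun _ i => star (v i)) := fun _ i h => by
  rw [hv i (star_ne_zero.1 h), CharTwo.add_self_eq_zero]
  rfl

theorem density_ket (v : A.ι → ℂ) : density (ket v) = vecMulVec v (star v) := by
  ext i j
  rw [density, ket, toMap_kraus]
  simp [krausMap_apply, Matrix.mul_apply, vecMulVec_apply]

theorem dualUnit_bra (v : A.ι → ℂ) : dualUnit (toMap (bra v)) = vecMulVec v (star v) := by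
  rw [bra, toMap_kraus, dualUnit_krausMap]
  ext i j
  simp [Matrix.mul_apply, vecMulVec_apply]

theorem prob_comp_bra (s : 𝟙_ DoubledSystem ⟶ A) (v : A.ι → ℂ) :
    doubledQuantumTheory.prob (s ≫ bra v) = (star v ⬝ᵥ density s *ᵥ v).re := by
  rw [prob_comp_eq, dualUnit_bra, trace_vecMulVec_star_mul]

theorem isTransf_ket {c : ZMod 2} {v : A.ι → ℂ} (hv : A.InSector c v) (h1 : star v ⬝ᵥ v ≤ 1) :
    doubledQuantumTheory.IsTransf (ket v) := by
  have h := isOperation_state_iff.1 (isOperation_kraus (hasParity_ket hv))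
  refine isTransf_state_iff.2 ⟨h.1, h.2, ?_⟩
  rw [density_ket, trace_vecMulVec, dotProduct_comm]
  exact h1

theorem isTransf_bra {c : ZMod 2} {v : A.ι → ℂ} (hv : A.InSector c v) (h1 : star v ⬝ᵥ v = 1) :
    doubledQuantumTheory.IsTransf (bra v) := by
  refine isTransf_iff.2 ⟨isOperation_kraus (hasParity_bra hv), ?_⟩
  rw [dualUnit_bra]
  -- the operator `1 - |v⟩⟨v|` is a projector
  have h2 : 1 - vecMulVec v (star v) =
      (1 - vecMulVec v (star v)) * (1 - vecMulVec v (star v))ᴴ := by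
    have h3 : (vecMulVec v (star v))ᴴ = vecMulVec v (star v) :=
      (posSemidef_vecMulVec_self_star v).isHermitian
    rw [conjTranspose_sub, conjTranspose_one, h3, Matrix.sub_mul, Matrix.mul_sub, Matrix.mul_sub,
      vecMulVec_mul_vecMulVec, h1]
    simp
  rw [h2]
  exact posSemidef_self_mul_conjTranspose _

/-- The deterministic effect `X ↦ tr X`. -/
noncomputable def discard (A : DoubledSystem) : A ⟶ 𝟙_ DoubledSystem :=
  ofMap
    (LinearMap.toSpanSingleton ℂ (𝟙_ DoubledSystem).Op 1 ∘ₗ traceLinearMap A.ι ℂ ℂ)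

theorem toMap_discard (X : A.Op) : toMap (discard A) X = X.trace • (1 : (𝟙_ DoubledSystem).Op) :=
  rfl

theorem dualUnit_discard : dualUnit (toMap (discard A)) = 1 := by
  refine tracePreserving_iff.1 fun X => ?_
  rw [toMap_discard, trace_smul]
  simp

/-- The deterministic effect is unique. -/
theorem eq_discard {a : A ⟶ 𝟙_ DoubledSystem} (h : TracePreserving a) : a = discard A :=
  LinearMap.ext fun X => by
    change toMap a X = toMap (discard A) X
    ext i j
    rw [Subsingleton.elim i default, Subsingleton.elim j default, ← trace_unit (toMap a X),
      ← trace_unit (toMap (discard A) X), h, toMap_discard, trace_smul]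
    simp

theorem inSector_single (i : A.ι) : A.InSector (A.parity i) (Pi.single i 1) := by
  intro j hj
  by_cases h : j = i
  · rw [h]
  · exact absurd (Pi.single_eq_of_ne h _) hj

theorem vecMulVec_single_star {n : Type} [DecidableEq n] (i : n) :
    vecMulVec (Pi.single i 1) (star (Pi.single i 1)) = single i i (1 : ℂ) := by
  rw [← Pi.single_star, star_one, single_eq_single_vecMulVec_single]

theorem star_single_dotProduct (i : A.ι) :
    star (Pi.single i (1 : ℂ)) ⬝ᵥ (Pi.single i (1 : ℂ) : A.ι → ℂ) = 1 := by
  simp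

/-- The projective measurement in the basis of a system is a test. -/
theorem isTest_bra_single (A : DoubledSystem) :
    doubledQuantumTheory.IsTest fun i : A.ι => bra (Pi.single i 1) := by
  refine isTest_iff.2 ⟨fun i => isOperation_kraus (hasParity_bra (inSector_single i)), ?_⟩
  rw [tracePreserving_iff, toMap_sum]
  rw [dualUnit_sum]
  simp only [dualUnit_bra, vecMulVec_single_star]
  ext i j
  simp [Matrix.sum_apply, single_apply, Matrix.one_apply, ite_and]

theorem isChannel_discard : doubledQuantumTheory.IsChannel (discard A) := by
  have h := isTest_iff.1 (isTest_bra_single A)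
  rw [← eq_discard h.2]
  exact isChannel_iff.2 ⟨IsOperation.sum _ fun i _ => h.1 i, h.2⟩

theorem tracePreserving_of_isChannel {F : A ⟶ B} (h : doubledQuantumTheory.IsChannel F) :
    TracePreserving F := (isChannel_iff.1 h).2

/-- A block diagonal Hermitian matrix is positive semidefinite if its quadratic form is nonnegative
on the unit vectors of both sectors. -/
theorem posSemidef_of_inSector {J : D.Op} (hJ : J.IsHermitian) (hb : D.BlockDiagonal J)
    (h : ∀ c v, D.InSector c v → star v ⬝ᵥ v = 1 → 0 ≤ (star v ⬝ᵥ J *ᵥ v).re) :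
    J.PosSemidef := by
  have him : ∀ v : D.ι → ℂ, (star v ⬝ᵥ J *ᵥ v).im = 0 := by
    intro v
    have h1 : star (star v ⬝ᵥ J *ᵥ v) = star v ⬝ᵥ J *ᵥ v := by
      conv_rhs => rw [← hJ.eq]
      rw [star_dotProduct, star_mulVec, dotProduct_mulVec, star_star]
    rw [RCLike.star_def] at h1
    exact Complex.conj_eq_iff_im.1 h1
  have hsec : ∀ c v, D.InSector c v → 0 ≤ star v ⬝ᵥ J *ᵥ v := by
    intro c v hv
    by_cases hv0 : v = 0
    · simp [hv0]
    obtain ⟨s, hs⟩ : ∃ s : ℝ, (s : ℂ) = star v ⬝ᵥ v :=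
      ⟨(star v ⬝ᵥ v).re, (Complex.eq_re_of_ofReal_le (dotProduct_star_self_nonneg v)).symm⟩
    have hs0 : 0 < s := by
      have : 0 < star v ⬝ᵥ v := dotProduct_star_self_pos_iff.2 hv0
      rw [← hs] at this
      exact_mod_cast this
    have hr : (((Real.sqrt s)⁻¹ : ℝ) : ℂ) * (((Real.sqrt s)⁻¹ : ℝ) : ℂ) = ((s⁻¹ : ℝ) : ℂ) := by
      rw [← Complex.ofReal_mul, ← mul_inv, Real.mul_self_sqrt hs0.le]
    have h1 := h c ((((Real.sqrt s)⁻¹ : ℝ) : ℂ) • v)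
      (fun i hi => hv i (right_ne_zero_of_mul hi)) (by
      rw [star_smul, smul_dotProduct, dotProduct_smul, smul_smul, RCLike.star_def,
        Complex.conj_ofReal, hr, ← hs, smul_eq_mul, ← Complex.ofReal_mul, inv_mul_cancel₀ hs0.ne',
        Complex.ofReal_one])
    rw [star_smul, mulVec_smul, smul_dotProduct, dotProduct_smul, smul_smul, RCLike.star_def,
        Complex.conj_ofReal, hr, smul_eq_mul, Complex.re_ofReal_mul] at h1
    refine Complex.nonneg_iff.2 ⟨?_, (him v).symm⟩
    exact nonneg_of_mul_nonneg_right h1 (inv_pos.2 hs0)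
  refine .of_dotProduct_mulVec_nonneg hJ fun v => ?_
  -- a vector is the sum of its components in the two sectors, and `J` does not mix them
  let w : ZMod 2 → D.ι → ℂ := fun c i => if D.parity i = c then v i else 0
  have hw : ∀ c, D.InSector c (w c) := fun c i hi => by
    by_contra h'
    exact hi (if_neg h')
  have hsum : star v ⬝ᵥ J *ᵥ v = ∑ c, star (w c) ⬝ᵥ J *ᵥ (w c) := by
    simp only [dotProduct, mulVec, Finset.mul_sum, w, Pi.star_apply]
    refine Eq.trans ?_ Finset.sum_comm
    refine Finset.sum_congr rfl fun i _ => ?_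
    refine Eq.trans ?_ Finset.sum_comm
    refine Finset.sum_congr rfl fun j _ => ?_
    rw [Finset.sum_eq_single (D.parity i)]
    · by_cases hij : D.parity j = D.parity i
      · simp [hij]
      · simp [hij, hb i j fun h => hij h.symm]
    · intro c _ hc
      simp [hc.symm]
    · simp
  rw [hsum]
  exact Finset.sum_nonneg fun c _ => hsec c _ (hw c)

/-- The Choi matrix as an operator on the composite system. -/
def choiOp (F : A ⟶ B) : (B ⊗ A).Op := choi (toMap F)

theorem blockDiagonal_choiOp {F : A ⟶ B} (hF : IsGraded F) :
    (B ⊗ A).BlockDiagonal (choiOp F) := hF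

/-- The maximally entangled state of two copies of `A`, on which a transformation of one copy
imprints its Choi matrix up to a positive factor. -/
theorem exists_faithful_state (A : DoubledSystem) :
    ∃ (s : 𝟙_ DoubledSystem ⟶ A ⊗ A) (r : ℝ), 0 < r ∧ doubledQuantumTheory.IsTransf s ∧
      ∀ (B : DoubledSystem) (F : A ⟶ B), density (s ≫ F ▷ A) = (r : ℂ) • choiOp F := by
  have := A.nonempty_ι
  have hcard : (0 : ℝ) < Fintype.card A.ι := by exact_mod_cast Fintype.card_pos
  let w : (A ⊗ A).ι → ℂ := fun x : A.ι × A.ι => if x.1 = x.2 then (1 : ℂ) else 0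
  let Ω : (A ⊗ A).Op := vecMulVec w (star w)
  refine ⟨prepare ((((Fintype.card A.ι : ℝ)⁻¹ : ℝ) : ℂ) • Ω),
    (Fintype.card A.ι : ℝ)⁻¹, inv_pos.2 hcard, isTransf_state_iff.2 ?_, fun B F => ?_⟩
  · rw [density_prepare]
    refine ⟨(posSemidef_vecMulVec_self_star _).smul ?_, ?_, ?_⟩
    · exact_mod_cast (inv_pos.2 hcard).le
    · rintro ⟨i, i'⟩ ⟨j, j'⟩ h
      by_cases h1 : i = i' <;> by_cases h2 : j = j'
      · subst h1 h2
        refine absurd ?_ h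
        change A.parity i + A.parity i = A.parity j + A.parity j
        rw [CharTwo.add_self_eq_zero, CharTwo.add_self_eq_zero]
      all_goals
        change _ * ((if i = i' then (1 : ℂ) else 0) * star (if j = j' then (1 : ℂ) else 0)) = 0
        simp [h1, h2]
    · have : trace Ω = Fintype.card A.ι := by
        rw [trace_vecMulVec, dotProduct]
        refine (Fintype.sum_prod_type (α₁ := A.ι) (α₂ := A.ι) _).trans ?_
        change ∑ i : A.ι, ∑ j : A.ι,
          (if i = j then (1 : ℂ) else 0) * star (if i = j then (1 : ℂ) else 0) = _
        simp
      refine le_of_eq ?_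
      rw [trace_smul, this, smul_eq_mul]
      push_cast
      exact inv_mul_cancel₀ (by exact_mod_cast hcard.ne')
  · rw [density_comp, density_prepare]
    refine (map_smul (toMap (F ▷ A)) _ _).trans ?_
    rw [choiOp, choi_eq_tensorMap]
    rfl

end DoubledSystem

/-! ### The laws of an operational-probabilistic theory -/

namespace DoubledSystem

variable {A B D E : DoubledSystem}

/-- A parity-preserving bijection of bases is a channel. -/
theorem isChannel_relabel (e : A.ι ≃ B.ι) (he : ∀ i, B.parity (e i) = A.parity i) :
    doubledQuantumTheory.IsChannel (ofMap (relabel e) : A ⟶ B) := by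
  have h : (ofMap (relabel e) : A ⟶ B) = kraus (of fun k i => if e i = k then 1 else 0) := by
    apply hom_ext_choi
    rw [toMap_kraus, choi_krausMap]
    ext ⟨k, i⟩ ⟨l, j⟩
    change single i j (1 : ℂ) (e.symm k) (e.symm l) = _
    simp [single_apply, vecMulVec_apply, ← ite_and, ← Equiv.eq_symm_apply, and_comm]
  refine isChannel_iff.2 ⟨?_, fun X => ?_⟩
  · rw [h]
    refine isOperation_kraus (c := 0) fun k i hki => ?_
    have : e i = k := by
      by_contra h'
      exact hki (if_neg h')
    rw [← this, he, add_zero]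
  · exact Fintype.sum_equiv e.symm _ _ fun i => rfl

theorem isChannel_rightUnitor (A : DoubledSystem) : doubledQuantumTheory.IsChannel (ρ_ A).hom ∧
    doubledQuantumTheory.IsChannel (ρ_ A).inv :=
  ⟨isChannel_relabel (A := A ⊗ 𝟙_ _) (Equiv.prodPUnit A.ι) fun _ => (add_zero _).symm,
    isChannel_relabel (B := A ⊗ 𝟙_ _) (Equiv.prodPUnit A.ι).symm fun _ => add_zero _⟩

theorem isTest_comp {X Y : Type} [Fintype X] [Fintype Y] {f : X → (A ⟶ B)} {g : Y → (B ⟶ D)}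
    (hf : doubledQuantumTheory.IsTest f) (hg : doubledQuantumTheory.IsTest g) :
    doubledQuantumTheory.IsTest fun x : X × Y => f x.1 ≫ g x.2 := by
  refine isTest_iff.2 ⟨fun x => IsOperation.comp (hf.1 x.1) (hg.1 x.2), ?_⟩
  have h : ∑ x : X × Y, f x.1 ≫ g x.2 = (∑ x, f x) ≫ ∑ y, g y := by
    rw [Fintype.sum_prod_type, Preadditive.sum_comp]
    simp only [Preadditive.comp_sum]
  rw [h]
  exact fun Z => (hg.2 _).trans (hf.2 Z)

theorem isTest_tensor {X Y : Type} [Fintype X] [Fintype Y] {f : X → (A ⟶ B)} {g : Y → (D ⟶ E)}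
    (hf : doubledQuantumTheory.IsTest f) (hg : doubledQuantumTheory.IsTest g) :
    doubledQuantumTheory.IsTest fun x : X × Y => f x.1 ⊗ₘ g x.2 := by
  refine isTest_iff.2 ⟨fun x => IsOperation.tensor (hf.1 x.1) (hg.1 x.2), ?_⟩
  have h : ∑ x : X × Y, (f x.1 ⊗ₘ g x.2) = (∑ x, f x) ⊗ₘ ∑ y, g y := by
    rw [Fintype.sum_prod_type, sum_tensor]
    simp only [tensor_sum]
  rw [h]
  have h2 : traceLinearMap (B.ι × E.ι) ℂ ℂ ∘ₗ
      tensorMap (toMap (∑ x, f x)) (toMap (∑ y, g y)) = traceLinearMap (A.ι × D.ι) ℂ ℂ := by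
    refine kronecker_ext fun x y => ?_
    simp only [LinearMap.comp_apply, tensorMap_kronecker, traceLinearMap_apply, trace_kronecker]
    rw [hf.2, hg.2]
  exact fun Z => LinearMap.congr_fun h2 Z

theorem IsTransf.comp {F : A ⟶ B} {G : B ⟶ D} (hF : doubledQuantumTheory.IsTransf F)
    (hG : doubledQuantumTheory.IsTransf G) : doubledQuantumTheory.IsTransf (F ≫ G) := by
  obtain ⟨X, _, f, hf, x, rfl⟩ := hF
  obtain ⟨Y, _, g, hg, y, rfl⟩ := hG
  exact ⟨X × Y, inferInstance, _, isTest_comp hf hg, (x, y), rfl⟩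

theorem IsTransf.tensor {F : A ⟶ B} {G : D ⟶ E} (hF : doubledQuantumTheory.IsTransf F)
    (hG : doubledQuantumTheory.IsTransf G) : doubledQuantumTheory.IsTransf (F ⊗ₘ G) := by
  obtain ⟨X, _, f, hf, x, rfl⟩ := hF
  obtain ⟨Y, _, g, hg, y, rfl⟩ := hG
  exact ⟨X × Y, inferInstance, _, isTest_tensor hf hg, (x, y), rfl⟩

theorem exists_faithful_prob (A : DoubledSystem) :
    ∃ (s : 𝟙_ DoubledSystem ⟶ A ⊗ A) (r : ℝ), 0 < r ∧ doubledQuantumTheory.IsTransf s ∧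
      ∀ (B : DoubledSystem) (F : A ⟶ B) (w : (B ⊗ A).ι → ℂ),
        doubledQuantumTheory.prob (s ≫ F ▷ A ≫ bra w) = r * (star w ⬝ᵥ choiOp F *ᵥ w).re := by
  obtain ⟨s, r, hr, hs, h⟩ := exists_faithful_state A
  refine ⟨s, r, hr, hs, fun B F w => ?_⟩
  rw [← Category.assoc, prob_comp_bra, h, smul_mulVec, dotProduct_smul, smul_eq_mul,
    Complex.re_ofReal_mul]

theorem isHermitian_dualUnit {F : A ⟶ B} (h : (choi (toMap F)).IsHermitian) :
    (dualUnit (toMap F)).IsHermitian := by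
  ext i j
  change star (∑ k, toMap F (single i j 1) k k) = ∑ k, toMap F (single j i 1) k k
  rw [star_sum]
  exact Finset.sum_congr rfl fun k _ => h.apply (k, j) (k, i)

theorem eq_of_prob_eq {F G : A ⟶ B} (hF : IsOperation F) (hG : IsOperation G)
    (h : ∀ (R : DoubledSystem) (s : 𝟙_ DoubledSystem ⟶ A ⊗ R) (a : B ⊗ R ⟶ 𝟙_ DoubledSystem),
      doubledQuantumTheory.IsTransf s → doubledQuantumTheory.IsTransf a →
        doubledQuantumTheory.prob (s ≫ (F ▷ R) ≫ a) =
          doubledQuantumTheory.prob (s ≫ (G ▷ R) ≫ a)) : F = G := by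
  obtain ⟨s, r, hr, hs, hprob⟩ := exists_faithful_prob A
  have key : ∀ {F G : A ⟶ B}, IsOperation F → IsOperation G →
      (∀ w : (B ⊗ A).ι → ℂ, doubledQuantumTheory.IsTransf (bra w) →
        doubledQuantumTheory.prob (s ≫ F ▷ A ≫ bra w) =
          doubledQuantumTheory.prob (s ≫ G ▷ A ≫ bra w)) →
      (choiOp F - choiOp G).PosSemidef := by
    intro F G hF hG h
    refine posSemidef_of_inSector
      (IsHermitian.sub hF.posSemidef_choi.isHermitian hG.posSemidef_choi.isHermitian)
      (fun x y hxy => ?_) fun c w hw hw1 => ?_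
    · rw [Matrix.sub_apply, blockDiagonal_choiOp hF.isGraded x y hxy,
        blockDiagonal_choiOp hG.isGraded x y hxy, sub_zero]
    · have h1 := h w (isTransf_bra hw hw1)
      rw [hprob, hprob] at h1
      rw [sub_mulVec, dotProduct_sub, Complex.sub_re, mul_left_cancel₀ hr.ne' h1, sub_self]
  have h1 := key hF hG fun w hw => h A s (bra w) hs hw
  have h2 := key hG hF fun w hw => (h A s (bra w) hs hw).symm
  rw [← neg_sub] at h2
  exact hom_ext_choi (sub_eq_zero.1 (h1.eq_zero_of_neg h2))

/-- Arrows in the span of the transformations are graded and preserve Hermitian operators. -/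
theorem span_isTransf_le {F : A ⟶ B}
    (h : F ∈ Submodule.span ℝ {G : A ⟶ B | doubledQuantumTheory.IsTransf G}) :
    (choi (toMap F)).IsHermitian ∧ IsGraded F := by
  induction h using Submodule.span_induction with
  | mem F hF => exact ⟨(IsTransf.isOperation hF).posSemidef_choi.isHermitian,
      (IsTransf.isOperation hF).isGraded⟩
  | zero => exact ⟨IsOperation.zero.posSemidef_choi.isHermitian, IsOperation.zero.isGraded⟩
  | add F G _ _ hF hG =>
    rw [toMap_add, choi_add]
    refine ⟨hF.1.add hG.1, fun x y hxy => ?_⟩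
    rw [toMap_add, choi_add, Matrix.add_apply, hF.2 x y hxy, hG.2 x y hxy, add_zero]
  | smul r F _ hF =>
    rw [toMap_smul, choi_smul]
    refine ⟨?_, fun x y hxy => ?_⟩
    · rw [IsHermitian, conjTranspose_smul, hF.1.eq, RCLike.star_def, Complex.conj_ofReal]
    · rw [toMap_smul, choi_smul, Matrix.smul_apply, hF.2 x y hxy, smul_zero]

theorem isTransf_of_tendsto (F : ℕ → (A ⟶ B)) (G : A ⟶ B)
    (hF : ∀ n, doubledQuantumTheory.IsTransf (F n))
    (hG : G ∈ Submodule.span ℝ {H : A ⟶ B | doubledQuantumTheory.IsTransf H})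
    (h : ∀ (R : DoubledSystem) (s : 𝟙_ DoubledSystem ⟶ A ⊗ R) (a : B ⊗ R ⟶ 𝟙_ DoubledSystem),
      doubledQuantumTheory.IsTransf s → doubledQuantumTheory.IsTransf a →
        Filter.Tendsto (fun n => doubledQuantumTheory.prob (s ≫ (F n ▷ R) ≫ a)) Filter.atTop
          (nhds (doubledQuantumTheory.prob (s ≫ (G ▷ R) ≫ a)))) :
    doubledQuantumTheory.IsTransf G := by
  obtain ⟨hherm, hgr⟩ := span_isTransf_le hG
  refine isTransf_iff.2 ⟨isOperation_iff_choi.2 ⟨?_, hgr⟩, ?_⟩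
  · obtain ⟨s, r, hr, hs, hprob⟩ := exists_faithful_prob A
    refine posSemidef_of_inSector (D := B ⊗ A) hherm (blockDiagonal_choiOp hgr)
      fun c w hw hw1 => ?_
    have h1 := ge_of_tendsto' (h A s (bra w) hs (isTransf_bra hw hw1)) (b := 0) fun n => by
      rw [hprob]
      exact mul_nonneg hr.le (Complex.nonneg_iff.1
        ((IsTransf.isOperation (hF n)).posSemidef_choi.dotProduct_mulVec_nonneg w)).1
    rw [hprob] at h1
    exact nonneg_of_mul_nonneg_right h1 hr
  -- the probabilities `tr (F n |w⟩⟨w|) ≤ 1` pass to the limit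
  · refine posSemidef_of_inSector (isHermitian_one.sub (isHermitian_dualUnit hherm))
      (fun i j hij => ?_) fun c w hw hw1 => ?_
    · rw [Matrix.sub_apply, hgr.blockDiagonal_dualUnit i j hij,
        one_apply_ne fun h => hij (congrArg A.parity h), sub_zero]
    · have hprob : ∀ H : A ⟶ B, doubledQuantumTheory.prob
          ((ket w ≫ (ρ_ A).inv) ≫ (H ▷ 𝟙_ DoubledSystem) ≫ (ρ_ B).hom ≫ discard B) =
          (star w ⬝ᵥ dualUnit (toMap H) *ᵥ w).re := by
        intro H
        have h1 : (ket w ≫ (ρ_ A).inv) ≫ (H ▷ 𝟙_ DoubledSystem) ≫ (ρ_ B).hom ≫ discard B =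
            (ket w ≫ H) ≫ discard B := by simp
        rw [h1, prob_comp_eq, dualUnit_discard, Matrix.one_mul, density_comp, trace_apply_eq,
          density_ket, trace_mul_comm, trace_vecMulVec_star_mul]
      have h1 := le_of_tendsto' (h _ (ket w ≫ (ρ_ A).inv) ((ρ_ B).hom ≫ discard B)
        (IsTransf.comp (isTransf_ket hw hw1.le) (IsChannel.isTransf (isChannel_rightUnitor A).2))
        (IsTransf.comp (IsChannel.isTransf (isChannel_rightUnitor B).1)
          (IsChannel.isTransf isChannel_discard))) (b := 1) fun n => by
        rw [hprob]
        have h2 := (isTransf_iff.1 (hF n)).2.dotProduct_mulVec_nonneg w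
        rw [sub_mulVec, one_mulVec, dotProduct_sub, hw1] at h2
        have h3 := (Complex.nonneg_iff.1 h2).1
        rw [Complex.sub_re, Complex.one_re] at h3
        linarith
      rw [hprob] at h1
      rw [sub_mulVec, one_mulVec, dotProduct_sub, hw1, Complex.sub_re, Complex.one_re]
      linarith

theorem scalar_eq {s : 𝟙_ DoubledSystem ⟶ 𝟙_ DoubledSystem} (hs : IsOperation s) :
    density s = (doubledQuantumTheory.prob s : ℂ) • 1 := by
  have h1 : 0 ≤ density s default default := (isOperation_state_iff.1 hs).1.diag_nonneg
  ext i j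
  rw [Subsingleton.elim i default, Subsingleton.elim j default, prob_eq,
    ← Complex.eq_re_of_ofReal_le h1]
  simp

theorem tensor_scalar {s : 𝟙_ DoubledSystem ⟶ 𝟙_ DoubledSystem} (hs : IsOperation s) (F : A ⟶ B) :
    (s ⊗ₘ F) ≫ (λ_ B).hom = (λ_ A).hom ≫ (doubledQuantumTheory.prob s • F) := by
  have hs' : s = doubledQuantumTheory.prob s • 𝟙 (𝟙_ DoubledSystem) :=
    state_ext (scalar_eq hs)
  conv_lhs => rw [hs']
  have h : (doubledQuantumTheory.prob s • 𝟙 (𝟙_ DoubledSystem)) ⊗ₘ F =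
      doubledQuantumTheory.prob s • (𝟙_ DoubledSystem ◁ F) := by
    rw [MonoidalCategory.tensorHom_def, MonoidalLinear.smul_whiskerRight, Linear.smul_comp,
      id_whiskerRight, Category.id_comp]
  rw [h, Linear.smul_comp, Linear.comp_smul, leftUnitor_naturality]

theorem convex_isTransf (A B : DoubledSystem) :
    Convex ℝ {F : A ⟶ B | doubledQuantumTheory.IsTransf F} := by
  intro F hF G hG p q hp hq hpq
  obtain ⟨hF1, hF2⟩ := isTransf_iff.1 hF
  obtain ⟨hG1, hG2⟩ := isTransf_iff.1 hG
  refine isTransf_iff.2 ⟨(hF1.smul hp).add (hG1.smul hq), ?_⟩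
  have h : 1 - dualUnit (toMap (p • F + q • G)) =
      (p : ℂ) • (1 - dualUnit (toMap F)) + (q : ℂ) • (1 - dualUnit (toMap G)) := by
    have hpq' : (p : ℂ) + q = 1 := by exact_mod_cast hpq
    have h1 : dualUnit (toMap (p • F + q • G)) =
        (p : ℂ) • dualUnit (toMap F) + (q : ℂ) • dualUnit (toMap G) := by
      ext i j
      simp [toMap_add, toMap_smul, dualUnit]
    have h2 : (1 : A.Op) = (p : ℂ) • 1 + (q : ℂ) • 1 := by rw [← add_smul, hpq', one_smul]
    rw [h1, smul_sub, smul_sub]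
    conv_lhs => rw [h2]
    abel
  rw [h]
  exact (hF2.smul (by exact_mod_cast hp)).add (hG2.smul (by exact_mod_cast hq))

theorem finiteDimensional_hom (A B : DoubledSystem) : FiniteDimensional ℝ (A ⟶ B) :=
  have : Module.Finite ℝ (A.Op →ₗ[ℂ] B.Op) := Module.Finite.trans ℂ _
  this

end DoubledSystem

open DoubledSystem

theorem doubledQuantumTheory_isOPT : doubledQuantumTheory.IsOPT where
  id_channel A := isChannel_relabel (Equiv.refl A.ι) fun _ => rfl
  associator_channel A B D :=
    ⟨isChannel_relabel (A := (A ⊗ B) ⊗ D) (B := A ⊗ B ⊗ D) (Equiv.prodAssoc A.ι B.ι D.ι)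
      fun _ => (add_assoc _ _ _).symm,
    isChannel_relabel (A := A ⊗ B ⊗ D) (B := (A ⊗ B) ⊗ D) (Equiv.prodAssoc A.ι B.ι D.ι).symm
      fun _ => add_assoc _ _ _⟩
  leftUnitor_channel A :=
    ⟨isChannel_relabel (A := 𝟙_ _ ⊗ A) (Equiv.punitProd A.ι) fun _ => (zero_add _).symm,
    isChannel_relabel (B := 𝟙_ _ ⊗ A) (Equiv.punitProd A.ι).symm fun _ => zero_add _⟩
  rightUnitor_channel := isChannel_rightUnitor
  swap_channel A B := isChannel_relabel (A := A ⊗ B) (B := B ⊗ A) (Equiv.prodComm A.ι B.ι)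
    fun _ => add_comm _ _
  comp_test _ _ _ _ _ _ _ _ _ := isTest_comp
  tensor_test _ _ _ _ _ _ _ _ _ _ := isTest_tensor
  coarse_test A B X Y _ _ c d r hd hc := by
    classical
    refine isTest_iff.2 ⟨fun x => ?_, ?_⟩
    · rw [hc.2 x]
      exact IsOperation.sum _ fun j _ => hd.1 j
    · have h : ∑ x, c x = ∑ y, d y := by
        simp only [hc.2]
        convert Finset.sum_fiberwise Finset.univ r d
      rw [h]
      exact hd.2
  prob_nonneg s hs :=
    (Complex.nonneg_iff.1 (isTransf_state_iff.1 hs).1.diag_nonneg).1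
  prob_sum X _ s hs := by
    rw [← map_sum]
    have h := hs.2 1
    rw [trace_unit, trace_unit] at h
    exact (congrArg Complex.re h).trans (by simp)
  prob_comp s t hs ht := by
    have h : density (s ≫ t) =
        ((doubledQuantumTheory.prob s * doubledQuantumTheory.prob t : ℝ) : ℂ) • 1 := by
      rw [density_comp, scalar_eq (IsTransf.isOperation hs), map_smul]
      change _ • density t = _
      rw [scalar_eq (IsTransf.isOperation ht), smul_smul, Complex.ofReal_mul]
    rw [prob_eq, h]
    simp
  prob_act A B s f hs _ := tensor_scalar (IsTransf.isOperation hs) f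
  separation A B f g hf hg h :=
    eq_of_prob_eq (IsTransf.isOperation hf) (IsTransf.isOperation hg) h
  finite A := have := finiteDimensional_hom (𝟙_ DoubledSystem) A
    inferInstance
  closed A B := isTransf_of_tendsto
  convex := convex_isTransf

/-! ### Pure transformations -/

namespace DoubledSystem

variable {A B D E : DoubledSystem}

/-- A transformation with a single Kraus operator is pure: the Choi matrices of its refinements are
dominated by a matrix of rank one. -/
theorem isPure_kraus {K : Matrix B.ι A.ι ℂ}
    (hK : doubledQuantumTheory.IsTransf (kraus K : A ⟶ B)) :
    doubledQuantumTheory.IsPure (kraus K : A ⟶ B) := by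
  classical
  refine ⟨hK, fun X Y _ _ c d r i hc hd hr hi => ?_⟩
  have hsum : (kraus K : A ⟶ B) = ∑ j ∈ Finset.univ.filter (fun j => r j = i), d j := by
    rw [← hi, hr.2 i]
  obtain ⟨j₀, hj₀⟩ := hr.1 i
  by_cases h0 : (kraus K : A ⟶ B) = 0
  -- all refinements of the zero transformation vanish
  · have hd0 : ∀ j, r j = i → d j = 0 := by
      intro j hj
      have h1 : choi (toMap (∑ j ∈ Finset.univ.filter (fun j => r j = i), d j)) = 0 := by
        rw [← hsum, h0]; rfl
      rw [← Finset.add_sum_erase _ _ (Finset.mem_filter.2 ⟨Finset.mem_univ j, hj⟩), toMap_add,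
        choi_add] at h1
      refine hom_ext_choi (PosSemidef.eq_zero_of_neg (IsOperation.posSemidef_choi (hd.1 j)) ?_)
      rw [neg_eq_of_add_eq_zero_right h1]
      exact IsOperation.posSemidef_choi (IsOperation.sum _ fun j _ => hd.1 j)
    refine ⟨fun j => if j = j₀ then 1 else 0, fun j _ => by positivity, ?_, fun j hj => ?_⟩
    · rw [Finset.sum_ite_eq']
      simp [hj₀]
    · rw [hd0 j hj, h0, smul_zero]
  · have hp : ∀ j, ∃ p : ℝ, r j = i → 0 ≤ p ∧ d j = p • (kraus K : A ⟶ B) := by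
      intro j
      by_cases hj : r j = i
      swap
      · exact ⟨0, fun h => absurd h hj⟩
      have h1 : (choi (toMap (kraus K : A ⟶ B)) - choi (toMap (d j))).PosSemidef := by
        have h2 : choi (toMap (kraus K : A ⟶ B)) - choi (toMap (d j)) = choi (toMap
            (∑ j ∈ (Finset.univ.filter (fun j => r j = i)).erase j, d j)) := by
          rw [hsum, ← Finset.add_sum_erase _ _ (Finset.mem_filter.2 ⟨Finset.mem_univ j, hj⟩),
            toMap_add, choi_add, add_sub_cancel_left]
        rw [h2]
        exact IsOperation.posSemidef_choi (IsOperation.sum _ fun j _ => hd.1 j)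
      rw [toMap_kraus, choi_krausMap] at h1
      obtain ⟨p, hp0, hp⟩ := (IsOperation.posSemidef_choi (hd.1 j)).eq_smul_of_le_vecMulVec h1
      refine ⟨p, fun _ => ⟨hp0, hom_ext_choi ?_⟩⟩
      rw [hp, toMap_smul, choi_smul, toMap_kraus, choi_krausMap]
    choose p hp using hp
    refine ⟨p, fun j hj => (hp j hj).1, ?_, fun j hj => (hp j hj).2⟩
    have h1 : (∑ j ∈ Finset.univ.filter (fun j => r j = i), p j) • (kraus K : A ⟶ B) =
        (1 : ℝ) • (kraus K : A ⟶ B) := by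
      rw [Finset.sum_smul, one_smul]
      conv_rhs => rw [hsum]
      exact Finset.sum_congr rfl fun j hj => ((hp j (Finset.mem_filter.1 hj).2).2).symm
    convert smul_left_injective ℝ h0 h1

/-- If a pure transformation is the sum of a finite family of operations, these are proportional to
it. -/
theorem exists_smul_of_isPure {F : A ⟶ B} (hF : doubledQuantumTheory.IsPure F) {κ : Type}
    [Fintype κ] [Nonempty κ] {G : κ → (A ⟶ B)} (hG : ∀ j, IsOperation (G j)) (h : F = ∑ j, G j) :
    ∃ p : κ → ℝ, (∀ j, 0 ≤ p j) ∧ ∑ j, p j = 1 ∧ ∀ j, G j = p j • F := by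
  classical
  obtain ⟨hFop, H, hH, hFH⟩ := isTransf_iff_exists.1 hF.1
  let c : Bool → (A ⟶ B) := fun b => if b then F else H
  let d : Option κ → (A ⟶ B) := fun o => o.elim H G
  let r : Option κ → Bool := Option.isSome
  have hfib : Finset.univ.filter (fun o : Option κ => r o = true) =
      Finset.univ.map Function.Embedding.some := by
    ext o
    cases o <;> simp [r]
  obtain ⟨p, hp0, hp1, hp⟩ := hF.2 Bool (Option κ) c d r true
    (isTest_iff.2 ⟨by rintro (_ | _); exacts [hH, hFop], by simpa [c] using hFH⟩)
    (isTest_iff.2 ⟨by rintro (_ | j); exacts [hH, hG j], by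
      rw [Fintype.sum_option]
      change TracePreserving (H + ∑ j, G j)
      rwa [← h, add_comm]⟩)
    ⟨by
      rintro (_ | _)
      · exact ⟨none, rfl⟩
      · exact ⟨some (Classical.arbitrary κ), rfl⟩, by
      rintro (_ | _)
      · have : Finset.univ.filter (fun o : Option κ => r o = false) = {none} := by
          ext o
          cases o <;> simp [r]
        have h2 : c false = ∑ o ∈ Finset.univ.filter (fun o : Option κ => r o = false), d o := by
          rw [this]; simp [c, d]
        convert h2
      · have h2 : c true = ∑ o ∈ Finset.univ.filter (fun o : Option κ => r o = true), d o := by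
          rw [hfib, Finset.sum_map]; simpa [c, d] using h
        convert h2⟩ rfl
  refine ⟨fun j => p (some j), fun j => hp0 _ rfl, ?_, fun j => hp (some j) rfl⟩
  have h3 : ∑ o ∈ Finset.univ.filter (fun o : Option κ => r o = true), p o = 1 := by
    convert hp1
  rw [hfib, Finset.sum_map] at h3
  exact h3

/-- An operation that is proportional to all its summands has a single Kraus operator of definite
parity. -/
theorem exists_kraus_of_forall_smul {F : A ⟶ B} (hF : IsOperation F)
    (h : ∀ (κ : Type) [Fintype κ] [Nonempty κ] (G : κ → (A ⟶ B)), (∀ j, IsOperation (G j)) →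
      F = ∑ j, G j → ∃ p : κ → ℝ, (∀ j, 0 ≤ p j) ∧ ∑ j, p j = 1 ∧ ∀ j, G j = p j • F) :
    ∃ c K, HasParity A B c K ∧ F = kraus K := by
  obtain ⟨κ, _, K, hK, hsum⟩ := hF.exists_kraus
  rcases isEmpty_or_nonempty κ with hκ | hκ
  · refine ⟨0, 0, fun _ _ h => absurd rfl h, ?_⟩
    rw [hsum, Finset.univ_eq_empty, Finset.sum_empty, kraus_zero]
  obtain ⟨p, hp0, hp1, hp⟩ := h κ _ (fun j => isOperation_kraus (hK j).choose_spec) hsum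
  obtain ⟨j, hj⟩ : ∃ j, p j ≠ 0 := by
    by_contra! h
    simp [h] at hp1
  refine ⟨_, (((Real.sqrt (p j)⁻¹ : ℝ) : ℂ)) • K j, (hK j).choose_spec.smul _, ?_⟩
  rw [← smul_kraus (inv_nonneg.2 (hp0 j)), hp j, smul_smul, inv_mul_cancel₀ hj, one_smul]

/-- The pure transformations are those with a single Kraus operator of definite parity. -/
theorem IsPure.exists_kraus {F : A ⟶ B} (hF : doubledQuantumTheory.IsPure F) :
    ∃ c K, HasParity A B c K ∧ F = kraus K :=
  exists_kraus_of_forall_smul (IsTransf.isOperation hF.1)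
    fun _ _ _ _ hG h => exists_smul_of_isPure hF hG h

theorem purityPreservation : doubledQuantumTheory.PurityPreservation := by
  constructor
  · intro A B D f g hf hg
    have h := IsTransf.comp hf.1 hg.1
    obtain ⟨c, K, hK, rfl⟩ := IsPure.exists_kraus hf
    obtain ⟨c', L, hL, rfl⟩ := IsPure.exists_kraus hg
    rw [kraus_comp] at h ⊢
    exact isPure_kraus h
  · intro A B D E f g hf hg
    have h := IsTransf.tensor hf.1 hg.1
    obtain ⟨c, K, hK, rfl⟩ := IsPure.exists_kraus hf
    obtain ⟨c', L, hL, rfl⟩ := IsPure.exists_kraus hg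
    rw [kraus_tensor] at h ⊢
    exact isPure_kraus h

theorem causality : doubledQuantumTheory.Causality := by
  intro A B W X Y Z _ _ _ _ s c a b _ _ ha hb w x
  rw [← map_sum, ← map_sum]
  simp only [← Preadditive.comp_sum]
  rw [eq_discard ha.2, eq_discard hb.2]

theorem pureSharpness : doubledQuantumTheory.PureSharpness := by
  intro A
  obtain ⟨i⟩ := A.nonempty_ι
  have h1 := star_single_dotProduct i
  refine ⟨bra (Pi.single i 1), isPure_kraus (isTransf_bra (inSector_single i) h1),
    ket (Pi.single i 1), isTransf_ket (inSector_single i) h1.le, ?_⟩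
  rw [prob_comp_bra, density_ket, vecMulVec_mulVec, h1]
  simp

/-! ### Purification -/

/-- Pure states are given by vectors in one of the sectors. -/
theorem IsPure.exists_ket {s : 𝟙_ DoubledSystem ⟶ A} (hs : doubledQuantumTheory.IsPure s) :
    ∃ c v, A.InSector c v ∧ s = ket v := by
  obtain ⟨c, K, hK, rfl⟩ := IsPure.exists_kraus hs
  refine ⟨c, fun i => K i default, fun i hi => (hK i default hi).trans (zero_add c), ?_⟩
  have : K = of fun i _ => K i default := by
    ext i j
    rw [Subsingleton.elim j default]; rfl
  exact congrArg kraus this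

theorem ket_comp_kraus (v : A.ι → ℂ) (K : Matrix B.ι A.ι ℂ) :
    ket v ≫ (kraus K : A ⟶ B) = ket (K *ᵥ v) := by
  rw [ket, kraus_comp]
  rfl

/-- The vector of a composite system with coefficient matrix `V`. -/
def vec (V : Matrix A.ι B.ι ℂ) : (A ⊗ B).ι → ℂ := fun x : A.ι × B.ι => V x.1 x.2

theorem vec_surjective (v : (A ⊗ B).ι → ℂ) : ∃ V : Matrix A.ι B.ι ℂ, v = vec V :=
  ⟨of fun i j => v ((i, j) : A.ι × B.ι), rfl⟩

/-- The marginal of the pure state with coefficient matrix `V` has density matrix `V Vᴴ`. -/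
theorem density_marginal_ket (V : Matrix A.ι B.ι ℂ) :
    density (OPData.marginal (ket (vec V)) (discard B)) = V * Vᴴ := by
  let P : Matrix (A.ι × B.ι) (A.ι × B.ι) ℂ →ₗ[ℂ] A.Op :=
    { toFun := fun X => of fun i i' => ∑ j, X (i, j) (i', j)
      map_add' := fun X Y => by ext i i'; simp [Finset.sum_add_distrib]
      map_smul' := fun z X => by ext i i'; simp [Finset.mul_sum] }
  have h : toMap ((A ◁ discard B) ≫ (ρ_ A).hom) = P := by
    refine kronecker_ext (a := A.ι) (c := B.ι) fun x y => ?_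
    change relabel (Equiv.prodPUnit A.ι) (tensorMap LinearMap.id (toMap (discard B)) (x ⊗ₖ y)) = _
    rw [tensorMap_kronecker]
    ext i i'
    change x i i' * (y.trace * (1 : Matrix Unit Unit ℂ) () ()) = ∑ j, x i i' * y j j
    rw [← Finset.mul_sum, Matrix.one_apply_eq, mul_one]
    rfl
  rw [OPData.marginal, density_comp, h, density_ket]
  ext i i'
  change ∑ j, V i j * star (V i' j) = _
  rw [Matrix.mul_apply]
  rfl

theorem ket_vec_comp (V : Matrix A.ι B.ι ℂ) (W : B.Op) :
    ket (vec V) ≫ (A ◁ (kraus W : B ⟶ B)) = ket (vec (V * Wᵀ)) := by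
  let L : (A ⊗ B).Op := (1 : A.Op) ⊗ₖ W
  have h : A ◁ (kraus W : B ⟶ B) = kraus L := by
    rw [← id_tensorHom, ← kraus_one, kraus_tensor]
  rw [h, ket_comp_kraus]
  congr 1
  funext x
  change ∑ y : A.ι × B.ι, (1 : A.Op) x.1 y.1 * W x.2 y.2 * V y.1 y.2 = (V * Wᵀ) x.1 x.2
  rw [Fintype.sum_prod_type, Finset.sum_eq_single x.1]
  · simp [Matrix.mul_apply, mul_comm]
  · intro i _ hi
    simp [one_apply_ne hi.symm]
  · simp

/-- The part of a matrix whose column index has parity `c`. -/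
def colPart (c : ZMod 2) (V : Matrix A.ι B.ι ℂ) : Matrix A.ι {j : B.ι // B.parity j = c} ℂ :=
  V.submatrix id Subtype.val

/-- The Gram matrix of the columns of one parity is the corresponding block of the full one. -/
theorem colPart_gram {c : ZMod 2} {V : Matrix A.ι B.ι ℂ} (hV : (A ⊗ B).InSector c (vec V))
    (c' : ZMod 2) : colPart c' V * (colPart c' V)ᴴ =
      of fun i i' => if A.parity i = c + c' ∧ A.parity i' = c + c' then (V * Vᴴ) i i' else 0 := by
  have hpar : ∀ i j, V i j ≠ 0 → A.parity i = c + B.parity j := by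
    intro i j h
    have : A.parity i + B.parity j = c := hV ((i, j) : A.ι × B.ι) h
    rw [← this, add_assoc, CharTwo.add_self_eq_zero, add_zero]
  ext i i'
  rw [of_apply]
  have h1 : (colPart c' V * (colPart c' V)ᴴ) i i' =
      ∑ j, if B.parity j = c' then V i j * star (V i' j) else 0 := by
    rw [Matrix.mul_apply, ← Finset.sum_filter]
    exact (Finset.sum_subtype (Finset.univ.filter fun j => B.parity j = c') (by simp)
      fun j => V i j * star (V i' j)).symm
  rw [h1, Matrix.mul_apply]
  split_ifs with h
  · refine Finset.sum_congr rfl fun j _ => ?_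
    split_ifs with hj
    · rfl
    · by_cases hV0 : V i j = 0
      · simp [hV0]
      · exact absurd (add_left_cancel ((hpar i j hV0).symm.trans h.1)) hj
  · refine Finset.sum_eq_zero fun j _ => ?_
    split_ifs with hj
    · by_cases hV0 : V i j = 0
      · simp [hV0]
      by_cases hV1 : V i' j = 0
      · simp [hV1]
      exact absurd ⟨hj ▸ hpar i j hV0, hj ▸ hpar i' j hV1⟩ h
    · rfl

/-- Coefficient matrices of the same parity and with the same marginal differ by a unitary that
preserves the parity: the unitary is chosen in each sector separately. -/
theorem exists_even_unitary {c : ZMod 2} {V V' : Matrix A.ι B.ι ℂ}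
    (hV : (A ⊗ B).InSector c (vec V)) (hV' : (A ⊗ B).InSector c (vec V'))
    (h : V * Vᴴ = V' * V'ᴴ) :
    ∃ U ∈ unitaryGroup B.ι ℂ, HasParity B B 0 U ∧ V' = V * U := by
  have hc : ∀ c', ∃ U ∈ unitaryGroup {j : B.ι // B.parity j = c'} ℂ,
      colPart c' V' = colPart c' V * U := fun c' =>
    exists_unitary_of_mul_conjTranspose_eq (by rw [colPart_gram hV, colPart_gram hV', h])
  choose W hW hVW using hc
  let U₀ : Matrix (Σ c', {j : B.ι // B.parity j = c'}) (Σ c', {j : B.ι // B.parity j = c'}) ℂ :=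
    blockDiagonal' W
  let e : B.ι ≃ Σ c', {j : B.ι // B.parity j = c'} := (Equiv.sigmaFiberEquiv B.parity).symm
  have he : ∀ j, e j = ⟨B.parity j, j, rfl⟩ := fun j => rfl
  refine ⟨U₀.submatrix e e, ?_, ?_, ?_⟩
  · rw [mem_unitaryGroup_iff, star_eq_conjTranspose, conjTranspose_submatrix,
      submatrix_mul_equiv, blockDiagonal'_conjTranspose, ← blockDiagonal'_mul]
    have : (fun k => W k * (W k)ᴴ) = 1 := funext fun k => mem_unitaryGroup_iff.1 (hW k)
    rw [this, blockDiagonal'_one, submatrix_one_equiv]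
  · intro k i hki
    by_contra h'
    rw [add_zero] at h'
    refine hki ?_
    rw [submatrix_apply, he, he]
    exact blockDiagonal'_apply_ne W _ _ h'
  · ext i j
    have h1 : V' i j = ∑ k : {k // B.parity k = B.parity j}, V i k.1 * W _ k ⟨j, rfl⟩ :=
      congrFun (congrFun (hVW (B.parity j)) i) ⟨j, rfl⟩
    rw [h1, Matrix.mul_apply, ← Equiv.sum_comp (Equiv.sigmaFiberEquiv B.parity),
      Fintype.sum_sigma, Finset.sum_eq_single (B.parity j)]
    · refine Finset.sum_congr rfl fun k _ => ?_
      congr 1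
      rw [submatrix_apply, he j]
      have h2 : e (Equiv.sigmaFiberEquiv B.parity ⟨B.parity j, k⟩) = ⟨B.parity j, k⟩ :=
        Equiv.symm_apply_apply _ _
      rw [h2]
      exact (blockDiagonal'_apply_eq W _ _ _).symm
    · intro c' _ hc'
      refine Finset.sum_eq_zero fun k _ => ?_
      rw [submatrix_apply, he j]
      have h2 : e (Equiv.sigmaFiberEquiv B.parity ⟨c', k⟩) = ⟨c', k⟩ :=
        Equiv.symm_apply_apply _ _
      rw [h2]
      exact mul_eq_zero_of_right _ (blockDiagonal'_apply_ne W _ _ hc')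
    · simp

theorem isReversible_kraus {c : ZMod 2} {U : A.Op} (hU : U ∈ unitaryGroup A.ι ℂ)
    (hc : HasParity A A c U) : doubledQuantumTheory.IsReversible (kraus U : A ⟶ A) := by
  have h1 : Uᴴ * U = 1 := mem_unitaryGroup_iff'.1 hU
  have h2 : U * Uᴴ = 1 := mem_unitaryGroup_iff.1 hU
  have hc' : HasParity A A c Uᴴ := by
    intro k i h
    rw [conjTranspose_apply] at h
    rw [hc i k (star_ne_zero.1 h), add_assoc, CharTwo.add_self_eq_zero, add_zero]
  refine ⟨isTransf_iff.2 ⟨isOperation_kraus hc, ?_⟩, kraus Uᴴ,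
    isTransf_iff.2 ⟨isOperation_kraus hc', ?_⟩, ?_, ?_⟩
  · rw [toMap_kraus, dualUnit_krausMap, h1, sub_self]
    exact PosSemidef.zero
  · rw [toMap_kraus, dualUnit_krausMap, conjTranspose_conjTranspose, h2, sub_self]
    exact PosSemidef.zero
  · rw [kraus_comp, h1, kraus_one]
  · rw [kraus_comp, h2, kraus_one]

/-- Coefficient matrices of definite parities and with the same marginal differ by a unitary of
definite parity.  If the parities differ, the two sectors of the purifying system are first
exchanged. -/
theorem exists_unitary_hasParity {c c' : ZMod 2} {V V' : Matrix A.ι B.ι ℂ}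
    (hV : (A ⊗ B).InSector c (vec V)) (hV' : (A ⊗ B).InSector c' (vec V'))
    (h : V * Vᴴ = V' * V'ᴴ) :
    ∃ U ∈ unitaryGroup B.ι ℂ, (∃ d, HasParity B B d U) ∧ V' = V * U := by
  by_cases hcc : c = c'
  · subst hcc
    obtain ⟨U, hU, hU0, hVU⟩ := exists_even_unitary hV hV' h
    exact ⟨U, hU, ⟨0, hU0⟩, hVU⟩
  rcases B.shape with ⟨-, hB⟩ | ⟨-, hB⟩
  · obtain ⟨e, he⟩ := (exchange_iff _).1 hB
    let J : B.Op := of fun k i => if e i = k then 1 else 0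
    have hJ : J ∈ unitaryGroup B.ι ℂ := by
      rw [mem_unitaryGroup_iff', star_eq_conjTranspose]
      ext i j
      rw [Matrix.mul_apply]
      simp [J, Matrix.one_apply, eq_comm]
    have hJpar : HasParity B B 1 J := by
      intro k i hki
      have : e i = k := by
        by_contra h'
        exact hki (if_neg h')
      rw [← this, he]
    have hVJ : (A ⊗ B).InSector c' (vec (V * J)) := by
      rintro ⟨i, j⟩ hij
      obtain ⟨k, -, hk⟩ := Finset.exists_ne_zero_of_sum_ne_zero
        (show ∑ k, V i k * J k j ≠ 0 from hij)
      have h1 : A.parity i + B.parity k = c :=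
        hV ((i, k) : A.ι × B.ι) (left_ne_zero_of_mul hk)
      have h2 := hJpar k j (right_ne_zero_of_mul hk)
      have h3 : c' = c + 1 := by
        revert hcc
        clear * -
        revert c c'
        decide
      change A.parity i + B.parity j = c'
      rw [h3, ← h1, h2, add_assoc, add_assoc, CharTwo.add_self_eq_zero, add_zero]
    have h2 : V * J * (V * J)ᴴ = V' * V'ᴴ := by
      have : J * Jᴴ = 1 := mem_unitaryGroup_iff.1 hJ
      rw [conjTranspose_mul, Matrix.mul_assoc, ← Matrix.mul_assoc J, this, Matrix.one_mul, h]
    obtain ⟨U, hU, hU0, hVU⟩ := exists_even_unitary hVJ hV' h2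
    exact ⟨J * U, mul_mem hJ hU, ⟨_, hU0.mul hJpar⟩, by rw [hVU, Matrix.mul_assoc]⟩
  -- a trivial purifying system has one parity only, so both marginals vanish
  · have h0 : V * Vᴴ = 0 := by
      ext i i'
      by_contra hne
      have hne' : (V' * V'ᴴ) i i' ≠ 0 := by rwa [← h]
      obtain ⟨j, -, hj⟩ := Finset.exists_ne_zero_of_sum_ne_zero hne
      obtain ⟨j', -, hj'⟩ := Finset.exists_ne_zero_of_sum_ne_zero hne'
      have h1 : A.parity i + B.parity j = c :=
        hV ((i, j) : A.ι × B.ι) (left_ne_zero_of_mul hj)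
      have h2 : A.parity i + B.parity j' = c' :=
        hV' ((i, j') : A.ι × B.ι) (left_ne_zero_of_mul hj')
      exact hcc (by rw [← h1, ← h2, hB, hB])
    have hV0 : V = 0 := trace_mul_conjTranspose_self_eq_zero_iff.1 (by rw [h0, trace_zero])
    have hV0' : V' = 0 := trace_mul_conjTranspose_self_eq_zero_iff.1 (by rw [← h, h0, trace_zero])
    exact ⟨1, one_mem _, ⟨0, HasParity.one⟩, by rw [hV0, hV0', Matrix.zero_mul]⟩

/-- The system whose two sectors are copies of the Hilbert space of `A`. -/
def doubling (A : DoubledSystem) : DoubledSystem where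
  ι := ZMod 2 × A.ι
  parity := Prod.fst
  shape := Or.inl ⟨⟨(0, A.nonempty_ι.some)⟩, (exchange_iff _).2
    ⟨Equiv.prodCongr (Equiv.addRight 1) (Equiv.refl _), fun _ => rfl⟩⟩

/-- A state with density matrix `S Sᴴ` is purified by `∑ |v⟩ ⊗ |c,m⟩`, where `v` is the component
of parity `c` of column `m` of `S`. -/
theorem exists_purification (s : 𝟙_ DoubledSystem ⟶ A) (hs : doubledQuantumTheory.IsTransf s) :
    ∃ (B : DoubledSystem) (Ψ : 𝟙_ DoubledSystem ⟶ A ⊗ B) (e : B ⟶ 𝟙_ DoubledSystem),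
      doubledQuantumTheory.IsPurification s Ψ e := by
  obtain ⟨hpos, hb, htr⟩ := isTransf_state_iff.1 hs
  obtain ⟨S, hS⟩ := hpos.exists_eq_mul_conjTranspose
  let V : Matrix A.ι (doubling A).ι ℂ := of fun i (x : ZMod 2 × A.ι) =>
    if A.parity i = x.1 then S i x.2 else 0
  have hV : (A ⊗ doubling A).InSector 0 (vec V) := by
    rintro ⟨i, x⟩ hix
    have : A.parity i = x.1 := by
      by_contra h'
      exact hix (if_neg h')
    change A.parity i + x.1 = 0
    rw [this, CharTwo.add_self_eq_zero]
  have hVV : V * Vᴴ = density s := by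
    ext i i'
    have h1 : (V * Vᴴ) i i' = ∑ c, ∑ m, (if A.parity i = c then S i m else 0) *
        star (if A.parity i' = c then S i' m else 0) := by
      rw [Matrix.mul_apply]
      exact Fintype.sum_prod_type (α₁ := ZMod 2) (α₂ := A.ι) _
    rw [h1, Finset.sum_eq_single (A.parity i)]
    · by_cases hii : A.parity i = A.parity i'
      · rw [hS, Matrix.mul_apply]
        simp [hii]
      · rw [hb i i' hii]
        have hii' : A.parity i' ≠ A.parity i := fun h => hii h.symm
        simp [hii']
    · intro c _ hc
      simp [hc.symm]
    · simp
  refine ⟨doubling A, ket (vec V), discard _, isPure_kraus (isTransf_ket hV ?_), isChannel_discard,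
    state_ext (by rw [density_marginal_ket, hVV])⟩
  have h1 : star (vec V) ⬝ᵥ vec V = (V * Vᴴ).trace := by
    rw [dotProduct_comm]
    exact Fintype.sum_prod_type (α₁ := A.ι) (α₂ := (doubling A).ι) _
  rw [h1, hVV]
  exact htr

theorem purification : doubledQuantumTheory.Purification := by
  refine ⟨fun A s hs => exists_purification s hs, fun A B s Ψ Ψ' e e' _ h h' => ?_⟩
  obtain ⟨hΨ, he, hm⟩ := h
  obtain ⟨hΨ', he', hm'⟩ := h'
  rw [eq_discard (tracePreserving_of_isChannel he)] at hm ⊢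
  rw [eq_discard (tracePreserving_of_isChannel he')] at hm' ⊢
  obtain ⟨c, v, hv, rfl⟩ := IsPure.exists_ket hΨ
  obtain ⟨c', v', hv', rfl⟩ := IsPure.exists_ket hΨ'
  obtain ⟨V, rfl⟩ := vec_surjective v
  obtain ⟨V', rfl⟩ := vec_surjective v'
  have h : V * Vᴴ = V' * V'ᴴ := by
    rw [← density_marginal_ket, ← density_marginal_ket, hm, hm']
  obtain ⟨U, hU, ⟨d, hd⟩, hVU⟩ := exists_unitary_hasParity hv hv' h
  have hUT : Uᵀ ∈ unitaryGroup B.ι ℂ := by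
    rw [mem_unitaryGroup_iff, star_eq_conjTranspose]
    have h1 : Uᴴ * U = 1 := mem_unitaryGroup_iff'.1 hU
    have := congrArg transpose h1
    rwa [transpose_mul, transpose_one] at this
  have hdT : HasParity B B d Uᵀ := by
    intro k i h
    rw [hd i k h, add_assoc, CharTwo.add_self_eq_zero, add_zero]
  refine ⟨kraus Uᵀ, isReversible_kraus hUT hdT, ?_, ?_⟩
  · rw [ket_vec_comp, transpose_transpose, hVU]
  · refine (eq_discard fun X => ?_).symm
    rw [toMap_comp, toMap_discard]
    have h1 : Uᵀᴴ * Uᵀ = 1 := mem_unitaryGroup_iff'.1 hUT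
    rw [trace_smul, toMap_kraus, trace_apply_eq, dualUnit_krausMap, h1, Matrix.one_mul]
    simp

theorem isSharpWithPurification : doubledQuantumTheory.IsSharpWithPurification where
  causality := causality
  purityPreservation := purityPreservation
  pureSharpness := pureSharpness
  purification := purification

end DoubledSystem

/-! ### Reversible transformations -/

namespace DoubledSystem

variable {A B D E : DoubledSystem}

/-- An allowed unitary maps each sector to one sector, because it maps the block diagonal operator
`|i⟩⟨j|` with `i`, `j` of equal parity to a block diagonal operator; by invertibility different
sectors have different images. -/
theorem AllowedUnitary.exists_hasParity {U : A.Op} (hU : AllowedUnitary U) :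
    ∃ c, HasParity A A c U := by
  obtain ⟨hu, hb⟩ := hU
  have key : ∀ i j k l, A.parity i = A.parity j → U k i ≠ 0 → U l j ≠ 0 →
      A.parity k = A.parity l := by
    intro i j k l hij hki hlj
    by_contra hkl
    have h1 := hb (single i j 1) (fun x y hxy => by
      rw [single_apply, if_neg]
      rintro ⟨rfl, rfl⟩
      exact hxy hij) k l hkl
    simp [Matrix.mul_apply, single_apply, ite_and, hki, hlj] at h1
  have hcol : ∀ i, ∃ k, U k i ≠ 0 := by
    intro i
    by_contra! h
    have h1 : (Uᴴ * U) i i = 1 := by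
      rw [show Uᴴ * U = 1 from mem_unitaryGroup_iff'.1 hu, one_apply_eq]
    simp [Matrix.mul_apply, h] at h1
  have hrow : ∀ k, ∃ i, U k i ≠ 0 := by
    intro k
    by_contra! h
    have h1 : (U * Uᴴ) k k = 1 := by
      rw [show U * Uᴴ = 1 from mem_unitaryGroup_iff.1 hu, one_apply_eq]
    simp [Matrix.mul_apply, h] at h1
  rcases A.shape with ⟨⟨i₀⟩, hA⟩ | ⟨-, hA⟩
  swap
  · exact ⟨0, fun k i _ => by rw [hA, hA, add_zero]⟩
  obtain ⟨e, he⟩ := (exchange_iff _).1 hA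
  obtain ⟨k₀, hk₀⟩ := hcol i₀
  obtain ⟨k₁, hk₁⟩ := hcol (e i₀)
  have hsplit : ∀ x y : ZMod 2, x = y ∨ x = y + 1 := by decide
  refine ⟨A.parity k₀ + A.parity i₀, fun k i hki => ?_⟩
  rcases hsplit (A.parity i) (A.parity i₀) with hi | hi
  · rw [key i i₀ k k₀ hi hki hk₀, hi, add_comm, add_assoc, CharTwo.add_self_eq_zero, add_zero]
  · have h1 : A.parity k = A.parity k₁ := key i (e i₀) k k₁ (by rw [hi, he]) hki hk₁
    rcases hsplit (A.parity k₁) (A.parity k₀) with h2 | h2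
    -- the columns of both parities would be supported in the same sector
    · exfalso
      obtain ⟨j, hj⟩ := hrow (e k₀)
      have h3 : A.parity (e k₀) = A.parity k₀ := by
        rcases hsplit (A.parity j) (A.parity i₀) with hj' | hj'
        · exact key j i₀ _ _ hj' hj hk₀
        · rw [key j (e i₀) _ k₁ (by rw [hj', he]) hj hk₁, h2]
      rw [he] at h3
      exact one_ne_zero (add_eq_left.1 h3)
    · rw [h1, h2, hi]
      generalize A.parity k₀ = x
      generalize A.parity i₀ = y
      revert x y
      decide

/-- Reversible transformations are proportional to all their summands, since the identity is. -/
theorem IsReversible.exists_kraus {F : A ⟶ A} (hF : doubledQuantumTheory.IsReversible F) :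
    ∃ c K, HasParity A A c K ∧ F = kraus K := by
  obtain ⟨hF, G, hG, hFG, hGF⟩ := hF
  refine exists_kraus_of_forall_smul (IsTransf.isOperation hF) fun κ _ _ H hH hsum => ?_
  have hid : doubledQuantumTheory.IsPure (𝟙 A) := by
    have h := doubledQuantumTheory_isOPT.id_channel A
    rw [← kraus_one] at h ⊢
    exact isPure_kraus (IsChannel.isTransf h)
  obtain ⟨p, hp0, hp1, hp⟩ := exists_smul_of_isPure hid (G := fun j => G ≫ H j)
    (fun j => (IsTransf.isOperation hG).comp (hH j)) (by rw [← Preadditive.comp_sum, ← hsum, hGF])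
  refine ⟨p, hp0, hp1, fun j => ?_⟩
  rw [← Category.id_comp (H j), ← hFG, Category.assoc, hp j, Linear.comp_smul, Category.comp_id]

theorem isReversible_iff {F : A ⟶ A} : doubledQuantumTheory.IsReversible F ↔
    ∃ U : A.Op, AllowedUnitary U ∧ F = conjugation U := by
  constructor
  · intro hF
    obtain ⟨c, K, hK, rfl⟩ := IsReversible.exists_kraus hF
    refine ⟨K, ⟨mem_unitaryGroup_iff'.2 ?_, fun X hX => hK.blockDiagonal hX⟩, rfl⟩
    obtain ⟨hF1, G, hG, hFG, hGF⟩ := hF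
    obtain ⟨c', L, hL, rfl⟩ := IsReversible.exists_kraus (F := G) ⟨hG, kraus K, hF1, hGF, hFG⟩
    -- both `1 - Kᴴ K` and `Kᴴ (1 - Lᴴ L) K = Kᴴ K - 1` are positive
    have h1 := (isTransf_iff.1 hF1).2
    have h2 := (isTransf_iff.1 hG).2.conjTranspose_mul_mul_same K
    rw [toMap_kraus, dualUnit_krausMap] at h1 h2
    have h3 : (L * K)ᴴ * (L * K) = 1 := by
      rw [← dualUnit_krausMap, ← toMap_kraus (A := A) (B := A), ← kraus_comp, hFG]
      exact (tracePreserving_iff_dualUnit _).1 fun X => rfl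
    rw [Matrix.mul_sub, Matrix.sub_mul, Matrix.mul_one] at h2
    rw [conjTranspose_mul] at h3
    have h4 : Kᴴ * (Lᴴ * L) * K = 1 := by rw [← h3]; simp only [Matrix.mul_assoc]
    rw [h4, ← neg_sub] at h2
    exact (sub_eq_zero.1 (h1.eq_zero_of_neg h2)).symm
  · rintro ⟨U, hU, rfl⟩
    obtain ⟨c, hc⟩ := hU.exists_hasParity
    exact isReversible_kraus hU.1 hc

/-! ### Random reversible channels and the sectors -/

/-- The projector on the sector of parity `c`. -/
def sectorProj (A : DoubledSystem) (c : ZMod 2) : A.Op :=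
  diagonal fun i => if A.parity i = c then 1 else 0

theorem HasParity.mul_sectorProj {c : ZMod 2} {U : A.Op} (hU : HasParity A A c U) (c' : ZMod 2) :
    U * sectorProj A c' = sectorProj A (c' + c) * U := by
  ext k i
  rw [sectorProj, sectorProj, mul_diagonal, diagonal_mul]
  by_cases h : U k i = 0
  · simp [h]
  · simp [hU k i h]

theorem HasParity.conj_sectorProj {c : ZMod 2} {U : A.Op} (hU : HasParity A A c U)
    (hu : U ∈ unitaryGroup A.ι ℂ) (c' : ZMod 2) :
    U * sectorProj A c' * Uᴴ = sectorProj A (c' + c) := by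
  rw [hU.mul_sectorProj, Matrix.mul_assoc, show U * Uᴴ = 1 from mem_unitaryGroup_iff.1 hu,
    Matrix.mul_one]

theorem HasParity.trace_sectorProj_conj {c : ZMod 2} {U : A.Op} (hU : HasParity A A c U)
    (hu : U ∈ unitaryGroup A.ι ℂ) (c' : ZMod 2) (X : A.Op) :
    (sectorProj A (c' + c) * (U * X * Uᴴ)).trace = (sectorProj A c' * X).trace := by
  rw [← Matrix.mul_assoc, ← Matrix.mul_assoc, ← hU.mul_sectorProj, trace_mul_comm,
    ← Matrix.mul_assoc, ← Matrix.mul_assoc, show Uᴴ * U = 1 from mem_unitaryGroup_iff'.1 hu,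
    Matrix.one_mul]

theorem RaReConvertible.exists_unitary {s t : 𝟙_ DoubledSystem ⟶ A}
    (h : doubledQuantumTheory.RaReConvertible s t) :
    ∃ (n : ℕ) (p : Fin n → ℝ) (U : Fin n → A.Op) (c : Fin n → ZMod 2), ∑ i, p i = 1 ∧
      (∀ i, U i ∈ unitaryGroup A.ι ℂ) ∧ (∀ i, HasParity A A (c i) (U i)) ∧
      density t = ∑ i, (p i : ℂ) • (U i * density s * (U i)ᴴ) := by
  obtain ⟨R, ⟨-, n, p, V, -, hp, hV, rfl⟩, rfl⟩ := h
  choose U hU hVU using fun i => isReversible_iff.1 (hV i)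
  choose c hc using fun i => (hU i).exists_hasParity
  refine ⟨n, p, U, c, hp, fun i => (hU i).1, hc, ?_⟩
  rw [Preadditive.comp_sum, density_sum]
  refine Finset.sum_congr rfl fun i _ => ?_
  rw [Linear.comp_smul, density_smul, hVU]
  rfl

theorem raReConvertible_of_allowedUnitary {M N U : A.Op} (hU : AllowedUnitary U)
    (h : N = U * M * Uᴴ) :
    doubledQuantumTheory.RaReConvertible (prepare M) (prepare N) := by
  have hrev := isReversible_iff.2 ⟨U, hU, rfl⟩
  refine ⟨conjugation U, ⟨isChannel_iff.2 ⟨IsTransf.isOperation hrev.1, tracePreserving_iff.2 ?_⟩,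
    1, fun _ => 1, fun _ => conjugation U, fun _ => zero_le_one, by simp, fun _ => hrev, by simp⟩,
    state_ext ?_⟩
  · exact (dualUnit_krausMap U).trans (mem_unitaryGroup_iff'.1 hU.1)
  · rw [density_comp, density_prepare, density_prepare, h]
    rfl

/-! ### Perfectly distinguishable states -/

/-- Perfectly distinguishable states are normalised and have orthogonal density matrices: each of
the discriminating effects fixes its own density matrix and annihilates the others. -/
theorem PerfectlyDistinguishable.orthogonal {X : Type} [Fintype X]
    {s : X → (𝟙_ DoubledSystem ⟶ A)} (h : doubledQuantumTheory.PerfectlyDistinguishable s) :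
    (∀ x, (density (s x)).trace = 1) ∧
      ∀ x y, x ≠ y → density (s x) * density (s y) = 0 := by
  classical
  obtain ⟨hs, a, ha, h1, h0⟩ := h
  have hpos : ∀ x, (density (s x)).PosSemidef := fun x => (isTransf_state_iff.1 (hs x)).1
  have hE : ∀ x, (dualUnit (toMap (a x))).PosSemidef := fun x =>
    posSemidef_dualUnit (IsOperation.posSemidef_choi (ha.1 x))
  have hsum : ∑ y, dualUnit (toMap (a y)) = 1 := by
    rw [← dualUnit_sum, ← toMap_sum]
    exact tracePreserving_iff.1 ha.2
  have hzero : ∀ x y, x ≠ y → dualUnit (toMap (a y)) * density (s x) = 0 := by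
    intro x y hxy
    refine (hE y).mul_eq_zero_of_trace (hpos x) ?_
    have h2 := h0 x y hxy
    rw [prob_comp_eq] at h2
    rw [Complex.eq_re_of_ofReal_le ((hE y).trace_mul_nonneg (hpos x)), h2, Complex.ofReal_zero]
  have hone : ∀ x, dualUnit (toMap (a x)) * density (s x) = density (s x) := by
    intro x
    have h2 : (∑ y, dualUnit (toMap (a y))) * density (s x) = density (s x) := by
      rw [hsum, Matrix.one_mul]
    rwa [Finset.sum_mul, Finset.sum_eq_single x (fun y _ hy => hzero x y hy.symm) (by simp)] at h2
  refine ⟨fun x => ?_, fun x y hxy => ?_⟩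
  · have h2 := h1 x
    rw [prob_comp_eq, hone] at h2
    rw [Complex.eq_re_of_ofReal_le (hpos x).trace_nonneg, h2, Complex.ofReal_one]
  · have h2 : density (s x) * dualUnit (toMap (a y)) = 0 := by
      have := congrArg conjTranspose (hzero x y hxy)
      rwa [conjTranspose_mul, (hpos x).isHermitian.eq, (hE y).isHermitian.eq,
        conjTranspose_zero] at this
    rw [← hone y, ← Matrix.mul_assoc, h2, Matrix.zero_mul]

/-- There are at most as many perfectly distinguishable states as basis vectors: non-zero columns of
their density matrices are orthogonal vectors. -/
theorem PerfectlyDistinguishable.card_le {X : Type} [Fintype X]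
    {s : X → (𝟙_ DoubledSystem ⟶ A)} (h : doubledQuantumTheory.PerfectlyDistinguishable s) :
    Fintype.card X ≤ Fintype.card A.ι := by
  obtain ⟨htr, horth⟩ := PerfectlyDistinguishable.orthogonal h
  have hcol : ∀ x, ∃ j, (fun i => density (s x) i j) ≠ 0 := by
    intro x
    by_contra! h0
    have h1 : density (s x) = 0 := by
      ext i j
      exact congrFun (h0 j) i
    have h2 := htr x
    rw [h1, trace_zero] at h2
    exact zero_ne_one h2
  choose j hj using hcol
  let v : X → EuclideanSpace ℂ A.ι := fun x => WithLp.toLp 2 fun i => density (s x) i (j x)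
  have hli : LinearIndependent ℂ v := by
    refine linearIndependent_of_ne_zero_of_inner_eq_zero (𝕜 := ℂ) (fun x hx => hj x ?_)
      fun x y hxy => ?_
    · exact congrArg WithLp.ofLp hx
    · change inner ℂ (v x) (v y) = 0
      rw [EuclideanSpace.inner_eq_star_dotProduct]
      have h1 := congrFun (congrFun (horth x y hxy) (j x)) (j y)
      rw [Matrix.mul_apply] at h1
      rw [dotProduct_comm]
      refine Eq.trans (Finset.sum_congr rfl fun i _ => ?_) h1
      have h2 := (isTransf_state_iff.1 (h.1 x)).1.isHermitian.apply (j x) i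
      rw [← h2]
      rfl
  simpa using hli.fintype_card_le_finrank

/-- The states of the basis vectors of a system form a pure maximal set. -/
theorem isPureMaximal_basis {X : Type} [Fintype X] (e : X ≃ A.ι) :
    doubledQuantumTheory.IsPureMaximal fun x => ket (Pi.single (e x) (1 : ℂ) : A.ι → ℂ) := by
  have htr : ∀ x, doubledQuantumTheory.IsTransf (ket (Pi.single (e x) (1 : ℂ) : A.ι → ℂ)) :=
    fun x => isTransf_ket (inSector_single _) (star_single_dotProduct _).le
  refine ⟨fun x => isPure_kraus (htr x), ⟨htr, fun x => bra (Pi.single (e x) 1), ?_, ?_, ?_⟩, ?_⟩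
  · have h := isTest_iff.1 (isTest_bra_single A)
    refine isTest_iff.2 ⟨fun x => h.1 (e x), ?_⟩
    rw [Equiv.sum_comp e fun i => bra (Pi.single i (1 : ℂ) : A.ι → ℂ)]
    exact h.2
  · intro x
    rw [prob_comp_bra, density_ket, vecMulVec_mulVec, star_single_dotProduct]
    simp
  · intro x y hxy
    have : e y ≠ e x := fun h => hxy (e.injective h).symm
    rw [prob_comp_bra, density_ket, vecMulVec_mulVec]
    simp [this]
  · rintro ⟨s₀, hs₀⟩
    have h := PerfectlyDistinguishable.card_le hs₀
    rw [Fintype.card_option, Fintype.card_congr e] at h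
    omega

/-- If the density matrix satisfies `ρ² = r ρ`, the eigenvalues are `0` and `r`. -/
theorem IsSpectrum.eq_zero_or_eq {s : 𝟙_ DoubledSystem ⟶ A} {d : ℕ} {p : Fin d → ℝ}
    (h : doubledQuantumTheory.IsSpectrum s p) {r : ℝ}
    (hr : density s * density s = (r : ℂ) • density s) (i : Fin d) : p i = 0 ∨ p i = r := by
  obtain ⟨-, -, α, ⟨hpure, hpd, -⟩, hs⟩ := h
  obtain ⟨htr, horth⟩ := PerfectlyDistinguishable.orthogonal hpd
  have hsq : density (α i) * density (α i) = density (α i) := by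
    obtain ⟨c, v, -, hv⟩ := IsPure.exists_ket (hpure i)
    have h1 := htr i
    rw [hv, density_ket, trace_vecMulVec, dotProduct_comm] at h1
    rw [hv, density_ket, vecMulVec_mul_vecMulVec, h1, one_smul]
  have hmul : density s * density (α i) = (p i : ℂ) • density (α i) := by
    rw [hs, density_sum, Finset.sum_mul, Finset.sum_eq_single i]
    · rw [density_smul, smul_mul, hsq]
    · intro j _ hj
      rw [density_smul, smul_mul, horth j i hj, smul_zero]
    · simp
  have h1 : ((p i : ℂ) * p i - r * p i) • density (α i) = 0 := by
    have h2 := congrArg (· * density (α i)) hr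
    simp only [Matrix.mul_assoc, smul_mul, hmul, Matrix.mul_smul, smul_smul] at h2
    rw [sub_smul, h2, sub_self]
  have h2 : density (α i) ≠ 0 := by
    intro h0
    have h3 := htr i
    rw [h0, trace_zero] at h3
    exact zero_ne_one h3
  have h3 : p i * (p i - r) = 0 := by
    have := (smul_eq_zero.1 h1).resolve_right h2
    have h4 : p i * p i - r * p i = 0 := by exact_mod_cast this
    linarith
  rcases mul_eq_zero.1 h3 with h | h
  · exact Or.inl h
  · exact Or.inr (sub_eq_zero.1 h)

end DoubledSystem

/-! ### Majorisation -/

namespace OPData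

theorem decreasing_comp_perm {d : ℕ} (x : Fin d → ℝ) (σ : Equiv.Perm (Fin d)) :
    decreasing (x ∘ σ) = decreasing x := by
  funext i
  exact congrFun (Tuple.comp_perm_comp_sort_eq_comp_sort (f := x) (σ := σ)) (Fin.rev i)

theorem majorises_comp_perm {d : ℕ} (x : Fin d → ℝ) (σ : Equiv.Perm (Fin d)) :
    Majorises x (x ∘ σ) ∧ Majorises (x ∘ σ) x := by
  have h : ∑ i, x i = ∑ i, (x ∘ σ) i := (Equiv.sum_comp σ x).symm
  refine ⟨⟨fun k _ => ?_, h⟩, ⟨fun k _ => ?_, h.symm⟩⟩ <;> rw [decreasing_comp_perm]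

/-- Vectors with entries `0` and `r ≠ 0` and with equal sums are permutations of each other. -/
theorem exists_perm_of_eq_zero_or_eq {d : ℕ} {p q : Fin d → ℝ} {r : ℝ} (hr : r ≠ 0)
    (hp : ∀ i, p i = 0 ∨ p i = r) (hq : ∀ i, q i = 0 ∨ q i = r) (h : ∑ i, p i = ∑ i, q i) :
    ∃ σ : Equiv.Perm (Fin d), p = q ∘ σ := by
  classical
  have hcard : ∀ {p : Fin d → ℝ}, (∀ i, p i = 0 ∨ p i = r) →
      ∑ i, p i = Fintype.card {i // p i = r} * r := by
    intro p hp
    have h1 : ∀ i, p i = if p i = r then r else 0 := by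
      intro i
      rcases hp i with h | h
      · rw [h, if_neg hr.symm]
      · rw [if_pos h, h]
    rw [Finset.sum_congr rfl fun i _ => h1 i, ← Finset.sum_filter, Finset.sum_const,
      Fintype.card_subtype, nsmul_eq_mul]
  rw [hcard hp, hcard hq] at h
  have h2 : Fintype.card {i // p i = r} = Fintype.card {i // q i = r} := by
    exact_mod_cast mul_right_cancel₀ hr h
  let e := Fintype.equivOfCardEq h2
  refine ⟨e.extendSubtype, funext fun i => ?_⟩
  by_cases hi : p i = r
  · exact hi.trans (e.extendSubtype_mem i hi).symm
  · have h3 := e.extendSubtype_not_mem i hi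
    exact ((hp i).resolve_right hi).trans ((hq _).resolve_right h3).symm

end OPData

/-! ### The doubled qubit -/

namespace DoubledSystem

/-- The label of the basis vector `|x,k⟩` of the doubled qubit. -/
def label (x : ZMod 2) (k : Fin 2) : doubledQubit.ι := (x, k)

theorem proj_eq (x : ZMod 2) (k : Fin 2) :
    proj x k = single (label x k) (label x k) (1 : ℂ) := rfl

theorem proj_mul_proj (x y : ZMod 2) (k l : Fin 2) :
    proj x k * proj y l = if label x k = label y l then proj x k else 0 := by
  rw [proj_eq, proj_eq]
  split_ifs with h
  · rw [h, single_mul_single_same, mul_one]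
  · exact single_mul_single_of_ne _ _ _ _ h _

theorem posSemidef_proj (x : ZMod 2) (k : Fin 2) : (proj x k).PosSemidef := by
  rw [proj_eq, ← vecMulVec_single_star]
  exact posSemidef_vecMulVec_self_star _

theorem blockDiagonal_proj (x : ZMod 2) (k : Fin 2) : doubledQubit.BlockDiagonal (proj x k) := by
  intro i j hij
  rw [proj_eq, single_apply, if_neg]
  rintro ⟨rfl, rfl⟩
  exact hij rfl

theorem trace_proj (x : ZMod 2) (k : Fin 2) : (proj x k).trace = 1 := trace_single_eq_same _ _

/-- Equal mixtures of two basis states of the doubled qubit are normalised states. -/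
theorem isChannel_prepare_mixture (x y : ZMod 2) (k l : Fin 2) :
    doubledQuantumTheory.IsChannel (prepare ((1 / 2 : ℂ) • (proj x k + proj y l))) := by
  rw [isChannel_state_iff, density_prepare]
  refine ⟨((posSemidef_proj x k).add (posSemidef_proj y l)).smul ?_, fun i j hij => ?_, ?_⟩
  · rw [Complex.nonneg_iff]; norm_num
  · rw [Matrix.smul_apply, Matrix.add_apply, blockDiagonal_proj x k i j hij,
      blockDiagonal_proj y l i j hij, add_zero, smul_zero]
  · rw [trace_smul, trace_add, trace_proj, trace_proj]
    norm_num

theorem mixture_mul_self {x y : ZMod 2} {k l : Fin 2} (h : label x k ≠ label y l) :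
    ((1 / 2 : ℂ) • (proj x k + proj y l)) * ((1 / 2 : ℂ) • (proj x k + proj y l)) =
      ((1 / 2 : ℝ) : ℂ) • ((1 / 2 : ℂ) • (proj x k + proj y l)) := by
  rw [smul_mul, Matrix.mul_smul, add_mul, mul_add, mul_add, proj_mul_proj, proj_mul_proj,
    proj_mul_proj, proj_mul_proj, if_pos rfl, if_pos rfl, if_neg h, if_neg h.symm]
  simp

theorem isSpectrum_mixture (e : Fin 4 ≃ doubledQubit.ι) :
    doubledQuantumTheory.IsSpectrum
      (prepare ((1 / 2 : ℂ) • (proj (e 0).1 (e 0).2 + proj (e 1).1 (e 1).2)))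
      ![1 / 2, 1 / 2, 0, 0] := by
  refine ⟨fun i => ?_, ?_, _, isPureMaximal_basis e, state_ext ?_⟩
  · fin_cases i <;> norm_num
  · simp [Fin.sum_univ_four]; norm_num
  · rw [density_prepare, density_sum, Fin.sum_univ_four]
    simp only [density_smul, density_ket, vecMulVec_single_star]
    have hl : ∀ x : doubledQubit.ι, label x.1 x.2 = x := fun _ => rfl
    simp only [proj_eq, hl, smul_add]
    simp

theorem rhoQubit_eq_diagonal :
    rhoQubit = diagonal fun i : doubledQubit.ι => if i.1 = 0 then (1 / 2 : ℂ) else 0 := by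
  have h : (1 / 2 : ℂ) • (single ((0, 0) : ZMod 2 × Fin 2) (0, 0) (1 : ℂ) +
      single (0, 1) (0, 1) 1) =
      diagonal fun i : ZMod 2 × Fin 2 => if i.1 = 0 then (1 / 2 : ℂ) else 0 := by
    ext ⟨x, k⟩ ⟨y, l⟩
    have h2 : ∀ z : ZMod 2, z = 0 ∨ z = 1 := by decide
    have h2' : ∀ m : Fin 2, m = 0 ∨ m = 1 := by decide
    rcases h2 x with rfl | rfl <;> rcases h2' k with rfl | rfl <;>
      rcases h2 y with rfl | rfl <;> rcases h2' l with rfl | rfl <;>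
        simp
  exact h

theorem sigmaQubit_eq_diagonal :
    sigmaQubit = diagonal fun i : doubledQubit.ι => if i.2 = 0 then (1 / 2 : ℂ) else 0 := by
  have h : (1 / 2 : ℂ) • (single ((0, 0) : ZMod 2 × Fin 2) (0, 0) (1 : ℂ) +
      single (1, 0) (1, 0) 1) =
      diagonal fun i : ZMod 2 × Fin 2 => if i.2 = 0 then (1 / 2 : ℂ) else 0 := by
    ext ⟨x, k⟩ ⟨y, l⟩
    have h2 : ∀ z : ZMod 2, z = 0 ∨ z = 1 := by decide
    have h2' : ∀ m : Fin 2, m = 0 ∨ m = 1 := by decide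
    rcases h2 x with rfl | rfl <;> rcases h2' k with rfl | rfl <;>
      rcases h2 y with rfl | rfl <;> rcases h2' l with rfl | rfl <;>
        simp
  exact h

theorem charpoly_rhoQubit : rhoQubit.charpoly = sigmaQubit.charpoly := by
  rw [rhoQubit_eq_diagonal, sigmaQubit_eq_diagonal, charpoly_diagonal, charpoly_diagonal]
  exact Fintype.prod_equiv (Equiv.prodComm (Fin 2) (Fin 2)) _ _ fun _ => rfl

theorem rhoQubit_eq_sectorProj : rhoQubit = (1 / 2 : ℂ) • sectorProj doubledQubit 0 := by
  rw [rhoQubit_eq_diagonal, sectorProj, ← diagonal_smul]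
  congr 1
  funext i
  change _ = (1 / 2 : ℂ) * (if i.1 = 0 then 1 else 0)
  rw [mul_ite, mul_one, mul_zero]

theorem not_raReConvertible_rhoQubit :
    ¬ doubledQuantumTheory.RaReConvertible (prepare rhoQubit) (prepare sigmaQubit) := by
  intro h
  obtain ⟨n, p, U, c, -, hU, hc, hst⟩ := RaReConvertible.exists_unitary h
  rw [density_prepare, density_prepare] at hst
  -- images of `ρ` are combinations of the projectors on the sectors, whose diagonals are constant
  -- on each sector
  have h1 : sigmaQubit (label 0 0) (label 0 0) = sigmaQubit (label 0 1) (label 0 1) := by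
    rw [hst, Matrix.sum_apply, Matrix.sum_apply]
    refine Finset.sum_congr rfl fun i _ => ?_
    rw [rhoQubit_eq_sectorProj, Matrix.mul_smul, smul_mul, (hc i).conj_sectorProj (hU i),
      Matrix.smul_apply, Matrix.smul_apply, Matrix.smul_apply, Matrix.smul_apply, sectorProj,
      diagonal_apply_eq, diagonal_apply_eq]
    rfl
  rw [sigmaQubit_eq_diagonal, diagonal_apply_eq, diagonal_apply_eq] at h1
  simp [label] at h1

theorem not_raReConvertible_sigmaQubit :
    ¬ doubledQuantumTheory.RaReConvertible (prepare sigmaQubit) (prepare rhoQubit) := by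
  intro h
  obtain ⟨n, p, U, c, hp, hU, hc, hst⟩ := RaReConvertible.exists_unitary h
  rw [density_prepare, density_prepare] at hst
  -- `σ` has weight one half in both sectors, and so have its images
  have hsigma : ∀ c, (sectorProj doubledQubit c * sigmaQubit).trace = 1 / 2 := by
    intro c
    rw [sigmaQubit_eq_diagonal, sectorProj, diagonal_mul_diagonal, trace_diagonal]
    change ∑ i : ZMod 2 × Fin 2,
      (if i.1 = c then (1 : ℂ) else 0) * (if i.2 = 0 then 1 / 2 else 0) = _
    rw [Fintype.sum_prod_type]
    simp
  have hrho : (sectorProj doubledQubit 0 * rhoQubit).trace = 1 := by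
    rw [rhoQubit_eq_diagonal, sectorProj, diagonal_mul_diagonal, trace_diagonal]
    change ∑ i : ZMod 2 × Fin 2,
      (if i.1 = 0 then (1 : ℂ) else 0) * (if i.1 = 0 then 1 / 2 else 0) = _
    rw [Fintype.sum_prod_type]
    simp
  have h1 : (sectorProj doubledQubit 0 * rhoQubit).trace = 1 / 2 := by
    rw [hst, Finset.mul_sum, trace_sum]
    have h2 : ∀ i, (sectorProj doubledQubit 0 *
        ((p i : ℂ) • (U i * sigmaQubit * (U i)ᴴ))).trace = (p i : ℂ) * (1 / 2) := by
      intro i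
      have h3 := (hc i).trace_sectorProj_conj (hU i) (c i) sigmaQubit
      rw [CharTwo.add_self_eq_zero, hsigma] at h3
      rw [Matrix.mul_smul, trace_smul, h3, smul_eq_mul]
    rw [Finset.sum_congr rfl fun i _ => h2 i, ← Finset.sum_mul, ← Complex.ofReal_sum, hp]
    simp
  rw [hrho] at h1
  norm_num at h1

theorem isSpectrum_rhoQubit :
    doubledQuantumTheory.IsSpectrum (prepare rhoQubit) ![1 / 2, 1 / 2, 0, 0] :=
  let e : Fin 4 ≃ ZMod 2 × Fin 2 :=
    Equiv.ofBijective ![(0, 0), (0, 1), (1, 0), (1, 1)] (by decide)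
  isSpectrum_mixture e

theorem isSpectrum_sigmaQubit :
    doubledQuantumTheory.IsSpectrum (prepare sigmaQubit) ![1 / 2, 1 / 2, 0, 0] :=
  let e : Fin 4 ≃ ZMod 2 × Fin 2 :=
    Equiv.ofBijective ![(0, 0), (1, 0), (0, 1), (1, 1)] (by decide)
  isSpectrum_mixture e

theorem majorises_of_isSpectrum {d : ℕ} {p q : Fin d → ℝ}
    (hp : doubledQuantumTheory.IsSpectrum (prepare rhoQubit) p)
    (hq : doubledQuantumTheory.IsSpectrum (prepare sigmaQubit) q) :
    OPData.Majorises p q ∧ OPData.Majorises q p := by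
  have hr : rhoQubit * rhoQubit = ((1 / 2 : ℝ) : ℂ) • rhoQubit :=
    mixture_mul_self (by decide)
  have hs : sigmaQubit * sigmaQubit = ((1 / 2 : ℝ) : ℂ) • sigmaQubit :=
    mixture_mul_self (by decide)
  obtain ⟨σ, rfl⟩ := OPData.exists_perm_of_eq_zero_or_eq (r := 1 / 2) (by norm_num)
    (fun i => IsSpectrum.eq_zero_or_eq hp (by rwa [density_prepare]) i)
    (fun i => IsSpectrum.eq_zero_or_eq hq (by rwa [density_prepare]) i)
    (hp.2.1.trans hq.2.1.symm)
  exact (OPData.majorises_comp_perm q σ).symm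

theorem isChannel_rhoQubit : doubledQuantumTheory.IsChannel (prepare rhoQubit) :=
  isChannel_prepare_mixture 0 0 0 1

theorem isChannel_sigmaQubit : doubledQuantumTheory.IsChannel (prepare sigmaQubit) :=
  isChannel_prepare_mixture 0 1 0 0

theorem not_majorisationSufficesForRaRe :
    ¬ doubledQuantumTheory.MajorisationSufficesForRaRe := fun h =>
  not_raReConvertible_rhoQubit (h _ _ _ 4 _ _ isChannel_rhoQubit isChannel_sigmaQubit
    isSpectrum_rhoQubit isSpectrum_sigmaQubit
    (majorises_of_isSpectrum isSpectrum_rhoQubit isSpectrum_sigmaQubit).1)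

end DoubledSystem

theorem mainTheorem10 :
    -- Doubled Quantum Theory is an operational-probabilistic theory, sharp, with purification
    doubledQuantumTheory.IsOPT ∧ doubledQuantumTheory.IsSharpWithPurification ∧
    -- its reversible transformations of a system are the conjugations by allowed unitaries
    (∀ (A : DoubledSystem) (F : A ⟶ A), doubledQuantumTheory.IsReversible F ↔
      ∃ U : A.Op, DoubledSystem.AllowedUnitary U ∧ F = DoubledSystem.conjugation U) ∧
    -- `ρ` and `σ` are normalised states of the doubled qubit
    doubledQuantumTheory.IsChannel (DoubledSystem.prepare DoubledSystem.rhoQubit) ∧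
    doubledQuantumTheory.IsChannel (DoubledSystem.prepare DoubledSystem.sigmaQubit) ∧
    -- they have the same spectrum, as matrices and as states of the theory
    DoubledSystem.rhoQubit.charpoly = DoubledSystem.sigmaQubit.charpoly ∧
    doubledQuantumTheory.IsSpectrum (DoubledSystem.prepare DoubledSystem.rhoQubit)
      ![1 / 2, 1 / 2, 0, 0] ∧
    doubledQuantumTheory.IsSpectrum (DoubledSystem.prepare DoubledSystem.sigmaQubit)
      ![1 / 2, 1 / 2, 0, 0] ∧
    (∀ (d : ℕ) (p q : Fin d → ℝ),
      doubledQuantumTheory.IsSpectrum (DoubledSystem.prepare DoubledSystem.rhoQubit) p →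
      doubledQuantumTheory.IsSpectrum (DoubledSystem.prepare DoubledSystem.sigmaQubit) q →
        OPData.Majorises p q ∧ OPData.Majorises q p) ∧
    -- no allowed unitary maps `ρ` to `σ`
    (¬ ∃ U : DoubledSystem.doubledQubit.Op, DoubledSystem.AllowedUnitary U ∧
      DoubledSystem.sigmaQubit = U * DoubledSystem.rhoQubit * Uᴴ) ∧
    -- no RaRe channel converts one state into the other
    ¬ doubledQuantumTheory.RaReConvertible (DoubledSystem.prepare DoubledSystem.rhoQubit)
      (DoubledSystem.prepare DoubledSystem.sigmaQubit) ∧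
    ¬ doubledQuantumTheory.RaReConvertible (DoubledSystem.prepare DoubledSystem.sigmaQubit)
      (DoubledSystem.prepare DoubledSystem.rhoQubit) ∧
    -- majorisation is not sufficient for convertibility by RaRe channels
    ¬ doubledQuantumTheory.MajorisationSufficesForRaRe := by
  exact ⟨doubledQuantumTheory_isOPT, DoubledSystem.isSharpWithPurification,
    fun _ _ => DoubledSystem.isReversible_iff, DoubledSystem.isChannel_rhoQubit,
    DoubledSystem.isChannel_sigmaQubit, DoubledSystem.charpoly_rhoQubit,
    DoubledSystem.isSpectrum_rhoQubit, DoubledSystem.isSpectrum_sigmaQubit,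
    fun _ _ _ => DoubledSystem.majorises_of_isSpectrum,
    fun ⟨_, hU, h⟩ => DoubledSystem.not_raReConvertible_rhoQubit
      (DoubledSystem.raReConvertible_of_allowedUnitary hU h),
    DoubledSystem.not_raReConvertible_rhoQubit, DoubledSystem.not_raReConvertible_sigmaQubit,
    DoubledSystem.not_majorisationSufficesForRaRe⟩
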